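/- Let $1\le d<D$ be integers, let $\mathrm{L}^*\subset\mathbb R^D$ be a fixed $d$-dimensional linear subspace with orthogonal complement $\mathrm{L}^{*\perp}$, and let $\mathbf P_{\mathrm{L}^*},\mathbf P_{\mathrm{L}^{*\perp}}$ be the $D\times D$ matrices of the orthogonal projections onto them. Let $\alpha_0,\alpha_1,\sigma_0,\sigma_1>0$ with $\alpha_0+\alpha_1=1$, and let $$\mu=\alpha_0\,N\!\left(\mathbf 0,\tfrac{\sigma_0^2}{D}\mathbf I\right)+\alpha_1\,N\!\left(\mathbf 0,\tfrac{\sigma_1^2}{d}\mathbf P_{\mathrm{L}^*}\mathbf P_{\mathrm{L}^*}^T\right)$$ be the needle-haystack mixture measure on $\mathbb R^D$. Let $\mathcal X$ be an i.i.d. sample of size $N$ from $\mu$, and put $\mathcal X_1=\mathcal X\cap\mathrm{L}^*$, $\mathcal X_0=\mathcal X\setminus\mathrm{L}^*$. Let $\mathbb H=\{\mathbf Q\in\mathbb R^{D\times D}:\mathbf Q=\mathbf Q^T,\ \operatorname{tr}\mathbf Q=1\}$. If $$\frac{\alpha_1}{\alpha_0}>\frac{\sigma_0}{\sigma_1}\cdot\frac{\sqrt{2/\pi}+1/4+1/10}{\sqrt{2/\pi}-1/4-1/10}\,\sqrt{\frac{d^2}{D}}\qquad\text{and}\qquad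 N>64\,\max\!\left(\frac{2d}{\alpha_1},\frac{2d}{\alpha_0},\frac{2(D-d)}{\alpha_0}\right),$$ then, with probability at least $1-e^{-\alpha_1^2N/2}-2e^{-\alpha_0^2N/2}-e^{-\alpha_1N/800}-e^{-\alpha_0N/800}$, both of the following inequalities hold: $$\min_{\mathbf Q\in\mathbb H,\ \mathbf Q\mathbf P_{\mathrm{L}^{*\perp}}=\mathbf 0}\ \sum_{\mathbf x\in\mathcal X_1}\|\mathbf Q\mathbf x\|>\sqrt2\min_{\mathbf v\in\mathrm{L}^{*\perp},\,\|\mathbf v\|=1}\ \sum_{\mathbf x\in\mathcal X_0}|\mathbf v^T\mathbf x|,$$ $$\min_{\mathbf Q\in\mathbb H,\ \mathbf Q\mathbf P_{\mathrm{L}^{*\perp}}=\mathbf 0}\ \sum_{\mathbf x\in\mathcal X_1}\|\mathbf Q\mathbf x\|>\sqrt2\max_{\mathbf v\in\mathrm{L}^*,\,\|\mathbf v\|=1}\ \sum_{\mathbf x\in\mathcal X_0}|\mathbf v^T\mathbf x|.$$ -/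

import Mathlib

open MeasureTheory ProbabilityTheory

noncomputable section

namespace NeedleHaystack

/-- The matrix (in the standard basis of `ℝ^D`) of the orthogonal projection onto `L`. -/
def projMatrix {D : ℕ} (L : Submodule ℝ (EuclideanSpace ℝ (Fin D))) :
    Matrix (Fin D) (Fin D) ℝ :=
  (Matrix.toEuclideanCLM (n := Fin D) (𝕜 := ℝ)).symm L.starProjection

/-- The class `ℍ` of real symmetric `D × D` matrices of trace one. -/
def traceOneSymm (D : ℕ) : Set (Matrix (Fin D) (Fin D) ℝ) :=
  {Q | Q = Q.transpose ∧ Q.trace = 1}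

/-- The outlier distribution `μ₀ = N(0, σ₀² I / D)` on `ℝ^D`. -/
def outlierMeasure (D : ℕ) (σ₀ : ℝ) : Measure (EuclideanSpace ℝ (Fin D)) :=
  multivariateGaussian 0 ((σ₀ ^ 2 / (D : ℝ)) • (1 : Matrix (Fin D) (Fin D) ℝ))

/-- The inlier distribution `μ₁ = N(0, σ₁² P_L P_Lᵀ / d)` on `ℝ^D`, where `d = dim L`. -/
def inlierMeasure {D : ℕ} (L : Submodule ℝ (EuclideanSpace ℝ (Fin D))) (σ₁ : ℝ) :
    Measure (EuclideanSpace ℝ (Fin D)) :=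
  multivariateGaussian 0
    ((σ₁ ^ 2 / (Module.finrank ℝ L : ℝ)) • (projMatrix L * (projMatrix L).transpose))

/-- The needle-haystack mixture measure `μ = α₀ μ₀ + α₁ μ₁`. -/
def mixtureMeasure {D : ℕ} (L : Submodule ℝ (EuclideanSpace ℝ (Fin D))) (α₀ α₁ σ₀ σ₁ : ℝ) :
    Measure (EuclideanSpace ℝ (Fin D)) :=
  ENNReal.ofReal α₀ • outlierMeasure D σ₀ + ENNReal.ofReal α₁ • inlierMeasure L σ₁

open Classical in
/-- `∑_{x ∈ 𝒳₁} ‖Q x‖`, the sum over the data points that lie in `L`. -/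
def inlierSum {D N : ℕ} (L : Submodule ℝ (EuclideanSpace ℝ (Fin D)))
    (x : Fin N → EuclideanSpace ℝ (Fin D)) (Q : Matrix (Fin D) (Fin D) ℝ) : ℝ :=
  ∑ i with x i ∈ L, ‖Matrix.toEuclideanCLM (n := Fin D) (𝕜 := ℝ) Q (x i)‖

open Classical in
/-- `∑_{x ∈ 𝒳₀} |vᵀ x|`, the sum over the data points that do not lie in `L`. -/
def outlierSum {D N : ℕ} (L : Submodule ℝ (EuclideanSpace ℝ (Fin D)))
    (x : Fin N → EuclideanSpace ℝ (Fin D)) (v : EuclideanSpace ℝ (Fin D)) : ℝ :=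
  ∑ i with x i ∉ L, |inner ℝ v (x i)|

/-- The minimum of `∑_{x ∈ 𝒳₁} ‖Q x‖` over `Q ∈ ℍ` with `Q P_{L^⊥} = 0`. The admissible set is
nonempty for `L ≠ ⊥`, and then the infimum is attained (a seminorm on a finite-dimensional space
attains its minimum on every nonempty affine subspace). -/
def inlierMin {D N : ℕ} (L : Submodule ℝ (EuclideanSpace ℝ (Fin D)))
    (x : Fin N → EuclideanSpace ℝ (Fin D)) : ℝ :=
  sInf (inlierSum L x '' {Q | Q ∈ traceOneSymm D ∧ Q * projMatrix Lᗮ = 0})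

/-- The minimum of `∑_{x ∈ 𝒳₀} |vᵀ x|` over unit vectors `v ∈ L^⊥` (a continuous function on a
compact set, nonempty for `L ≠ ⊤`). -/
def outlierMinPerp {D N : ℕ} (L : Submodule ℝ (EuclideanSpace ℝ (Fin D)))
    (x : Fin N → EuclideanSpace ℝ (Fin D)) : ℝ :=
  sInf (outlierSum L x '' {v | v ∈ Lᗮ ∧ ‖v‖ = 1})

/-- The maximum of `∑_{x ∈ 𝒳₀} |vᵀ x|` over unit vectors `v ∈ L` (a continuous function on a
compact set, nonempty for `L ≠ ⊥`). -/
def outlierMax {D N : ℕ} (L : Submodule ℝ (EuclideanSpace ℝ (Fin D)))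
    (x : Fin N → EuclideanSpace ℝ (Fin D)) : ℝ :=
  sSup (outlierSum L x '' {v | v ∈ L ∧ ‖v‖ = 1})

/-- First recovery condition: the inlier minimum exceeds `√2` times the minimum over `L^⊥`. -/
def Condition1 {D N : ℕ} (L : Submodule ℝ (EuclideanSpace ℝ (Fin D)))
    (x : Fin N → EuclideanSpace ℝ (Fin D)) : Prop :=
  inlierMin L x > √2 * outlierMinPerp L x

/-- Second recovery condition: the inlier minimum exceeds `√2` times the maximum over `L`. -/
def Condition2 {D N : ℕ} (L : Submodule ℝ (EuclideanSpace ℝ (Fin D)))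
    (x : Fin N → EuclideanSpace ℝ (Fin D)) : Prop :=
  inlierMin L x > √2 * outlierMax L x

end NeedleHaystack

end

/-! The inlier minimum has order α₁Nσ₁/d and the outlier sums have order α₀Nσ₀/√D. With m =
0.562·(σ₁/d)·α₁N and M = 1.012·(σ₀/√D)·α₀N, the signal-to-noise assumption gives √2·M < m, so it
suffices to put the inlier minimum above m and the relevant outlier sums below M.

Diagonalising an admissible Q turns its sum into a weighted sum over eigenvectors in L, with total
weight at least tr Q = 1. Hence the inlier minimum is at least the minimum over unit u ∈ L of ∑ ⟨u,
x⟩²/‖x‖ (`le_norm_toEuclideanCLM`). The minimum over L^⊥ is bounded by its value at a single fixed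
unit vector. What remains uniform is a lower tail of ∑ ⟨u, x⟩²/‖x‖ and an upper tail of ∑ |⟨u, x⟩|,
both over the unit sphere of L.

Uniformity comes from smoothing instead of an ε-net (`measure_exists_setIntegral_ball_ge_le`). If E
exp Φ(θ) ≤ 1 for all ‖θ‖ < 1 + r, then the integral of exp Φ(θ) over that ball is controlled by
Markov's inequality. By Jensen, a unit u for which the average of Φ over the ball of radius r about
u reaches t forces this integral to be at least eᵗ times the volume of that small ball. The cost is
a factor ((1 + r)/r)^d, which N absorbs because αN ≥ 128d. Averaging |⟨θ, x⟩| over a ball only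
increases it, by convexity; averaging ⟨θ, x⟩²/‖x‖ adds an explicit multiple of ‖x‖, which is
subtracted in advance.

The one-point exponential moments use rotation invariance of the Gaussian on L and sharp lower
bounds for E‖g‖/√d. They are taken under the whole mixture, a point of the wrong component
contributing exponent 0, so the numbers of inliers and outliers never need separate control. The
terms exp(-α²N/2) in the claimed probability are therefore pure slack. -/

noncomputable section

namespace NeedleHaystack

/-! ### One-dimensional Gaussian moments and exponential moments -/

lemma sinh_le_mul_exp_sq_div_six {y : ℝ} (hy : 0 ≤ y) :
    Real.sinh y ≤ y * Real.exp (y ^ 2 / 6) := by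
  rw [Real.sinh_eq_tsum, Real.exp_eq_exp_ℝ, NormedSpace.exp_eq_tsum ℝ, ← tsum_mul_left]
  refine y.hasSum_sinh.summable.tsum_le_tsum (fun i ↦ ?_)
    ((NormedSpace.expSeries_summable' (𝕂 := ℝ) (y ^ 2 / 6)).mul_left y)
  -- The series are compared term by term: y^(2k+1)/(2k+1)! against y·(y²/6)^k/k!.
  have h : ∀ k : ℕ, (6 : ℝ) ^ k * (k.factorial : ℝ) ≤ ((2 * k + 1).factorial : ℝ) := by
    intro k
    induction k with
    | zero => simp
    | succ k ih =>
      rw [show 2 * (k + 1) + 1 = (2 * k + 1) + 1 + 1 by ring, Nat.factorial_succ (2 * k + 1 + 1),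
        Nat.factorial_succ (2 * k + 1), Nat.factorial_succ k]
      push_cast
      calc (6 : ℝ) ^ (k + 1) * (((k : ℝ) + 1) * (k.factorial : ℝ))
          = (6 * ((k : ℝ) + 1)) * ((6 : ℝ) ^ k * (k.factorial : ℝ)) := by ring
        _ ≤ ((2 * (k : ℝ) + 1 + 1 + 1) * (2 * k + 1 + 1)) * ((2 * k + 1).factorial : ℝ) := by
            refine mul_le_mul ?_ ih (by positivity) (by positivity)
            nlinarith [(Nat.cast_nonneg k : (0 : ℝ) ≤ k)]
        _ = _ := by ring
  rw [smul_eq_mul, div_pow, ← pow_mul, inv_mul_eq_div, div_div, pow_succ, mul_comm _ y,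
    mul_div_assoc]
  gcongr
  exact h i

lemma integrable_gaussianReal_iff {f : ℝ → ℝ} :
    Integrable f (gaussianReal 0 1) ↔ Integrable (fun x ↦ gaussianPDFReal 0 1 x * f x) := by
  rw [gaussianReal_of_var_ne_zero _ one_ne_zero,
    integrable_withDensity_iff_integrable_smul' (measurable_gaussianPDF _ _)
      (ae_of_all _ fun _ ↦ gaussianPDF_lt_top)]
  simp [toReal_gaussianPDF]

lemma gaussianPDFReal_mul_abs_pow_mul_exp (n : ℕ) (a x : ℝ) :
    gaussianPDFReal 0 1 x * (|x| ^ n * Real.exp (a * x ^ 2)) =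
      (√(2 * Real.pi))⁻¹ * (|x| ^ n * Real.exp (-(1 / 2 - a) * |x| ^ 2)) := by
  rw [gaussianPDFReal_def, sq_abs]
  have : Real.exp (-(1 / 2 - a) * x ^ 2) =
      Real.exp (-x ^ 2 / 2) * Real.exp (a * x ^ 2) := by
    rw [← Real.exp_add]; congr 1; ring
  simp only [NNReal.coe_one, mul_one, sub_zero]
  rw [this]; ring

lemma integrable_abs_pow_mul_exp (n : ℕ) {a : ℝ} (ha : a < 1 / 2) :
    Integrable (fun x ↦ |x| ^ n * Real.exp (a * x ^ 2)) (gaussianReal 0 1) := by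
  rw [integrable_gaussianReal_iff]
  simp_rw [gaussianPDFReal_mul_abs_pow_mul_exp]
  refine Integrable.const_mul ?_ _
  have h := (integrable_rpow_mul_exp_neg_mul_sq (b := 1 / 2 - a) (by linarith) (s := n)
    (by linarith [(Nat.cast_nonneg n : (0 : ℝ) ≤ n)])).norm
  refine h.congr (ae_of_all _ fun x ↦ ?_)
  simp [Real.abs_exp]

/-- A Gamma integral; the first absolute moment, the fourth moment and E exp(x²/4) below are all
special cases. -/
lemma integral_abs_pow_mul_exp (n : ℕ) {a : ℝ} (ha : a < 1 / 2) :
    ∫ x, |x| ^ n * Real.exp (a * x ^ 2) ∂(gaussianReal 0 1) =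
      (√(2 * Real.pi))⁻¹ *
        ((1 / 2 - a) ^ (-((n : ℝ) + 1) / 2) * Real.Gamma (((n : ℝ) + 1) / 2)) := by
  rw [integral_gaussianReal_eq_integral_smul one_ne_zero]
  simp_rw [smul_eq_mul, gaussianPDFReal_mul_abs_pow_mul_exp]
  rw [integral_const_mul, integral_comp_abs
    (f := fun x ↦ x ^ n * Real.exp (-(1 / 2 - a) * x ^ 2))]
  have h := integral_rpow_mul_exp_neg_mul_rpow (p := 2) (q := n) (b := 1 / 2 - a) (by norm_num)
    (by linarith [(Nat.cast_nonneg n : (0 : ℝ) ≤ n)]) (by linarith)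
  simp only [Real.rpow_natCast, Real.rpow_two] at h
  rw [h]; ring

lemma integral_abs_mul_exp {a : ℝ} (ha : a < 1 / 2) :
    ∫ x, |x| * Real.exp (a * x ^ 2) ∂(gaussianReal 0 1) = √(2 / Real.pi) / (1 - 2 * a) := by
  have h := integral_abs_pow_mul_exp 1 ha
  simp only [pow_one] at h
  rw [h, show (((1 : ℕ) : ℝ) + 1) / 2 = 1 by norm_num,
    show -(((1 : ℕ) : ℝ) + 1) / 2 = -1 by norm_num, Real.Gamma_one, Real.rpow_neg_one]
  have h2 : √(2 / Real.pi) = 2 * (√(2 * Real.pi))⁻¹ := by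
    rw [← Real.sqrt_inv, ← Real.sqrt_sq (show (0 : ℝ) ≤ 2 by norm_num),
      ← Real.sqrt_mul (by positivity)]
    congr 1
    rw [Real.sqrt_sq (show (0 : ℝ) ≤ 2 by norm_num)]
    field_simp
  rw [h2]
  have : (1 / 2 - a) ≠ 0 := by linarith
  have : (1 - 2 * a) ≠ 0 := by intro h; apply this; linarith
  field_simp

lemma integral_abs_gaussianReal : ∫ x, |x| ∂(gaussianReal 0 1) = √(2 / Real.pi) := by
  simpa using integral_abs_mul_exp (a := 0) (by norm_num)

lemma integral_exp_sq_div_four :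
    ∫ x, Real.exp (x ^ 2 / 4) ∂(gaussianReal 0 1) = √2 := by
  have h := integral_abs_pow_mul_exp 0 (a := 1 / 4) (by norm_num)
  simp only [pow_zero, one_mul] at h
  rw [show (fun x : ℝ ↦ Real.exp (x ^ 2 / 4)) = fun x ↦ Real.exp (1 / 4 * x ^ 2) by
    ext x; congr 1; ring, h]
  rw [show (((0 : ℕ) : ℝ) + 1) / 2 = 1 / 2 by norm_num,
    show -(((0 : ℕ) : ℝ) + 1) / 2 = -(1 / 2) by norm_num, Real.Gamma_one_half_eq,
    Real.rpow_neg (by norm_num), ← Real.sqrt_eq_rpow, ← Real.sqrt_inv, ← Real.sqrt_inv,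
    ← Real.sqrt_mul (by positivity), ← Real.sqrt_mul (by positivity)]
  congr 1
  field_simp
  norm_num

lemma integral_pow_four_gaussianReal : ∫ x, x ^ 4 ∂(gaussianReal 0 1) = 3 := by
  have h := integral_abs_pow_mul_exp 4 (a := 0) (by norm_num)
  simp only [zero_mul, Real.exp_zero, mul_one, Even.pow_abs (show Even 4 by decide)] at h
  rw [h, show (((4 : ℕ) : ℝ) + 1) / 2 = 1 / 2 + 1 + 1 by norm_num,
    show -(((4 : ℕ) : ℝ) + 1) / 2 = -(1 / 2) + (-2 : ℤ) by norm_num,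
    Real.Gamma_add_one (by norm_num), Real.Gamma_add_one (by norm_num), Real.Gamma_one_half_eq,
    Real.rpow_add (by norm_num), Real.rpow_intCast,
    Real.rpow_neg (by norm_num), ← Real.sqrt_eq_rpow, Real.sqrt_mul (by norm_num)]
  have : (√2 : ℝ) * √(1 / 2 - 0) = 1 := by
    rw [← Real.sqrt_mul (by norm_num)]; norm_num
  have hp : √Real.pi ≠ 0 := by positivity
  rw [show (√2 * √Real.pi)⁻¹ * ((√(1 / 2 - 0))⁻¹ * (1 / 2 - 0) ^ (-2 : ℤ) *
      ((1 / 2 + 1) * (1 / 2 * √Real.pi))) =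
      (√2 * √(1 / 2 - 0))⁻¹ * ((1 / 2 - 0) ^ (-2 : ℤ) * (3 / 4)) by
    rw [mul_inv, mul_inv]; field_simp; norm_num, this]
  norm_num

lemma integrable_exp_mul_abs (s : ℝ) :
    Integrable (fun x ↦ Real.exp (s * |x|)) (gaussianReal 0 1) :=
  integrable_exp_mul_abs_add (v := 0) (t := s) (X := id) (by simpa using integrable_exp_mul_gaussianReal s)
    (by simpa using integrable_exp_mul_gaussianReal (-s)) |>.congr (ae_of_all _ fun x ↦ by simp)

/-- Since exp(s|x|) = cosh(sx) + sinh(s|x|), the even part integrates exactly to exp(s²/2), and the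
bound sinh y ≤ y·exp(y²/6) makes the other part integrable in closed form. This keeps the
first-order term s·√(2/π) exact. -/
lemma integral_exp_mul_abs_le {s : ℝ} (hs : 0 ≤ s) (hs3 : s ^ 2 < 3) :
    ∫ x, Real.exp (s * |x|) ∂(gaussianReal 0 1) ≤
      Real.exp (s ^ 2 / 2) + s * (√(2 / Real.pi) / (1 - s ^ 2 / 3)) := by
  have hcosh : ∫ x, Real.cosh (s * x) ∂(gaussianReal 0 1) = Real.exp (s ^ 2 / 2) := by
    have h1 := fun t : ℝ ↦ congrFun (mgf_fun_id_gaussianReal (μ := 0) (v := 1)) t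
    simp only [mgf, zero_mul, NNReal.coe_one, one_mul, zero_add] at h1
    simp_rw [Real.cosh_eq]
    rw [integral_div, integral_add (integrable_exp_mul_gaussianReal s)
      (by simpa using integrable_exp_mul_gaussianReal (-s)), h1]
    have := h1 (-s)
    simp only [neg_mul, neg_sq] at this
    rw [this]; ring
  have hci : Integrable (fun x ↦ Real.cosh (s * x)) (gaussianReal 0 1) := by
    simp_rw [Real.cosh_eq]
    exact ((integrable_exp_mul_gaussianReal s).add
      (by simpa using integrable_exp_mul_gaussianReal (-s))).div_const 2
  have hai : Integrable (fun x ↦ |x| * Real.exp (s ^ 2 / 6 * x ^ 2)) (gaussianReal 0 1) := by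
    simpa using integrable_abs_pow_mul_exp 1 (a := s ^ 2 / 6) (by linarith)
  calc ∫ x, Real.exp (s * |x|) ∂(gaussianReal 0 1)
      ≤ ∫ x, (Real.cosh (s * x) + s * (|x| * Real.exp (s ^ 2 / 6 * x ^ 2))) ∂(gaussianReal 0 1) := by
        refine integral_mono (integrable_exp_mul_abs s) (hci.add (hai.const_mul s)) fun x ↦ ?_
        have h1 := sinh_le_mul_exp_sq_div_six (y := s * |x|) (by positivity)
        have h2 : Real.cosh (s * x) = Real.cosh (s * |x|) := by
          rw [← Real.cosh_abs (s * x), abs_mul, abs_of_nonneg hs]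
        have h3 : (s * |x|) ^ 2 / 6 = s ^ 2 / 6 * x ^ 2 := by rw [mul_pow, sq_abs]; ring
        rw [h3] at h1
        simp only
        rw [h2, ← Real.cosh_add_sinh]
        linarith
    _ = _ := by
        rw [integral_add hci (hai.const_mul s), integral_const_mul, hcosh,
          integral_abs_mul_exp (by linarith)]
        ring_nf

/-! ### Rotation-invariant measures and their moments -/

lemma exists_linearIsometryEquiv_apply_eq {V : Type*} [NormedAddCommGroup V]
    [InnerProductSpace ℝ V] {u v : V} (h : ‖u‖ = ‖v‖) : ∃ f : V ≃ₗᵢ[ℝ] V, f u = v :=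
  ⟨_, Submodule.reflection_sub h⟩

section Isotropic

set_option linter.unusedSectionVars false

variable {V : Type*} [NormedAddCommGroup V] [InnerProductSpace ℝ V] [FiniteDimensional ℝ V]
  [MeasurableSpace V] [BorelSpace V]

/-- A measure is isotropic if it is invariant under all linear isometries. -/
def IsIsotropic (ν : Measure V) : Prop := ∀ f : V ≃ₗᵢ[ℝ] V, ν.map f = ν

lemma isIsotropic_stdGaussian : IsIsotropic (stdGaussian V) := fun f ↦ stdGaussian_map f

lemma isIsotropic_volume_restrict_ball (r : ℝ) :
    IsIsotropic ((volume : Measure V).restrict (Metric.ball 0 r)) := by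
  intro f
  have h := (f.measurePreserving (E := V)).restrict_preimage (s := Metric.ball 0 r)
    Metric.isOpen_ball.measurableSet
  rw [f.preimage_ball, map_zero] at h
  exact h.map_eq

lemma IsIsotropic.integral_comp {ν : Measure V} (hν : IsIsotropic ν) (f : V ≃ₗᵢ[ℝ] V)
    (g : V → ℝ) : ∫ x, g (f x) ∂ν = ∫ x, g x ∂ν := by
  have := (f.toHomeomorph.measurableEmbedding.integral_map (μ := ν) g)
  have h2 : ν.map f.toHomeomorph = ν := hν f
  rw [h2] at this
  exact this.symm

lemma IsIsotropic.integral_inner_pow_congr {ν : Measure V} (hν : IsIsotropic ν) (n : ℕ)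
    (w : ℝ → ℝ) {u v : V} (h : ‖u‖ = ‖v‖) :
    ∫ x, inner ℝ u x ^ n * w ‖x‖ ∂ν = ∫ x, inner ℝ v x ^ n * w ‖x‖ ∂ν := by
  obtain ⟨f, rfl⟩ := exists_linearIsometryEquiv_apply_eq h
  rw [← hν.integral_comp f (fun x ↦ inner ℝ (f u) x ^ n * w ‖x‖)]
  simp

lemma integrable_mul_norm_of_bound {ν : Measure V} {w : ℝ → ℝ} (hw : Measurable w)
    {n : ℕ} (hi : Integrable (fun x : V ↦ ‖x‖ ^ n * w ‖x‖) ν) {g : V → ℝ} (hg : Continuous g)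
    {C : ℝ} (hC : ∀ x, |g x| ≤ C * ‖x‖ ^ n) :
    Integrable (fun x ↦ g x * w ‖x‖) ν := by
  refine (hi.norm.const_mul C).mono'
    (hg.measurable.mul (hw.comp measurable_norm)).aestronglyMeasurable (ae_of_all _ fun x ↦ ?_)
  rw [norm_mul, norm_mul, Real.norm_eq_abs, norm_pow, norm_norm, ← mul_assoc]
  exact mul_le_mul_of_nonneg_right (hC x) (norm_nonneg _)

lemma abs_inner_sq_mul_inner_sq_le (u v x : V) :
    |inner ℝ u x ^ 2 * inner ℝ v x ^ 2| ≤ ‖u‖ ^ 2 * ‖v‖ ^ 2 * ‖x‖ ^ 4 := by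
  have h1 := abs_real_inner_le_norm u x
  have h2 := abs_real_inner_le_norm v x
  rw [abs_mul, abs_pow, abs_pow]
  calc |inner ℝ u x| ^ 2 * |inner ℝ v x| ^ 2 ≤ (‖u‖ * ‖x‖) ^ 2 * (‖v‖ * ‖x‖) ^ 2 := by gcongr
    _ = _ := by ring

/-- All directions of an orthonormal basis give the same integral, and their squares add up to ‖x‖².
The radial weight `w` is kept so that 1/‖x‖ can be inserted later. -/
lemma IsIsotropic.integral_inner_sq {ν : Measure V} (hν : IsIsotropic ν) {w : ℝ → ℝ}
    (hw : Measurable w) (hi : Integrable (fun x : V ↦ ‖x‖ ^ 2 * w ‖x‖) ν) (u : V) :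
    Module.finrank ℝ V * ∫ x, inner ℝ u x ^ 2 * w ‖x‖ ∂ν =
      ‖u‖ ^ 2 * ∫ x, ‖x‖ ^ 2 * w ‖x‖ ∂ν := by
  have hint : ∀ v : V, Integrable (fun x ↦ inner ℝ v x ^ 2 * w ‖x‖) ν := fun v ↦
    integrable_mul_norm_of_bound hw hi (g := fun x ↦ inner ℝ v x ^ 2) (by fun_prop)
      (C := ‖v‖ ^ 2) fun x ↦ by
        rw [abs_pow, ← mul_pow]; gcongr; exact abs_real_inner_le_norm v x
  let b := stdOrthonormalBasis ℝ V
  have h : ∀ j, ∫ x, inner ℝ u x ^ 2 * w ‖x‖ ∂ν =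
      ‖u‖ ^ 2 * ∫ x, inner ℝ (b j) x ^ 2 * w ‖x‖ ∂ν := by
    intro j
    rw [hν.integral_inner_pow_congr 2 w (u := u) (v := ‖u‖ • b j) (by simp [norm_smul]),
      ← integral_const_mul]
    simp_rw [real_inner_smul_left, mul_pow, mul_assoc]
  have hs : ∑ j, ∫ x, inner ℝ (b j) x ^ 2 * w ‖x‖ ∂ν = ∫ x, ‖x‖ ^ 2 * w ‖x‖ ∂ν := by
    rw [← integral_finsetSum _ fun j _ ↦ hint (b j)]
    simp_rw [← Finset.sum_mul, b.sum_sq_inner_right]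
  rw [← hs, Finset.mul_sum, ← Finset.sum_congr rfl fun j _ ↦ h j]
  simp

/-- Polarisation: (a + b)⁴ + (a - b)⁴ = 2a⁴ + 2b⁴ + 12a²b². As u ± v have norm √2, invariance makes
the left side 8W and the fourth powers on the right 4W, where W is the integral for one unit
direction. -/
lemma IsIsotropic.integral_inner_sq_mul_inner_sq {ν : Measure V} (hν : IsIsotropic ν)
    {w : ℝ → ℝ} (hw : Measurable w) (hi : Integrable (fun x : V ↦ ‖x‖ ^ 4 * w ‖x‖) ν)
    {u v : V} (hu : ‖u‖ = 1) (hv : ‖v‖ = 1) (huv : inner ℝ u v = 0) :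
    3 * ∫ x, inner ℝ u x ^ 2 * inner ℝ v x ^ 2 * w ‖x‖ ∂ν =
      ∫ x, inner ℝ u x ^ 4 * w ‖x‖ ∂ν := by
  have hint2 : ∀ u v : V, Integrable (fun x ↦ inner ℝ u x ^ 2 * inner ℝ v x ^ 2 * w ‖x‖) ν :=
    fun u v ↦ integrable_mul_norm_of_bound hw hi
      (g := fun x ↦ inner ℝ u x ^ 2 * inner ℝ v x ^ 2) (by fun_prop)
      (abs_inner_sq_mul_inner_sq_le u v)
  have hint : ∀ u : V, Integrable (fun x ↦ inner ℝ u x ^ 4 * w ‖x‖) ν := fun u ↦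
    (hint2 u u).congr (ae_of_all _ fun x ↦ by simp only; ring)
  have hadd : ‖u + v‖ = ‖√2 • u‖ := by
    rw [norm_smul, hu, Real.norm_of_nonneg (Real.sqrt_nonneg 2), mul_one,
      ← Real.sqrt_sq (norm_nonneg _), norm_add_sq_real, hu, hv, huv]
    norm_num
  have hsub : ‖u - v‖ = ‖√2 • u‖ := by
    rw [norm_smul, hu, Real.norm_of_nonneg (Real.sqrt_nonneg 2), mul_one,
      ← Real.sqrt_sq (norm_nonneg _), norm_sub_sq_real, hu, hv, huv]
    norm_num
  have h4 : ∫ x, inner ℝ (√2 • u) x ^ 4 * w ‖x‖ ∂ν = 4 * ∫ x, inner ℝ u x ^ 4 * w ‖x‖ ∂ν := by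
    rw [← integral_const_mul]
    congr 1; ext x
    rw [real_inner_smul_left, mul_pow, show (√2 : ℝ) ^ 4 = (√2 ^ 2) ^ 2 by ring,
      Real.sq_sqrt (by norm_num)]
    ring
  have h1 := hν.integral_inner_pow_congr 4 w hadd
  have h2 := hν.integral_inner_pow_congr 4 w hsub
  have h3 := hν.integral_inner_pow_congr 4 w (hu.trans hv.symm)
  have hI : Integrable (fun x ↦ 2 * (inner ℝ u x ^ 4 * w ‖x‖) + 2 * (inner ℝ v x ^ 4 * w ‖x‖)) ν :=
    ((hint u).const_mul 2).add ((hint v).const_mul 2)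
  have key : ∫ x, inner ℝ (u + v) x ^ 4 * w ‖x‖ ∂ν + ∫ x, inner ℝ (u - v) x ^ 4 * w ‖x‖ ∂ν =
      (2 * ∫ x, inner ℝ u x ^ 4 * w ‖x‖ ∂ν + 2 * ∫ x, inner ℝ v x ^ 4 * w ‖x‖ ∂ν) +
      12 * ∫ x, inner ℝ u x ^ 2 * inner ℝ v x ^ 2 * w ‖x‖ ∂ν := by
    rw [← integral_add (hint _) (hint _), ← integral_const_mul, ← integral_const_mul,
      ← integral_const_mul, ← integral_add ((hint u).const_mul 2) ((hint v).const_mul 2),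
      ← integral_add hI ((hint2 u v).const_mul 12)]
    congr 1; ext x
    simp only [inner_add_left, inner_sub_left]
    ring
  rw [h1, h2, h4, ← h3] at key
  linarith

/-- Expanding ‖x‖⁴ in an orthonormal basis gives d diagonal terms W and d(d - 1) mixed terms W/3, in
total d(d + 2)W/3. -/
lemma IsIsotropic.integral_inner_pow_four {ν : Measure V} (hν : IsIsotropic ν)
    {w : ℝ → ℝ} (hw : Measurable w) (hi : Integrable (fun x : V ↦ ‖x‖ ^ 4 * w ‖x‖) ν) (u : V) :
    (Module.finrank ℝ V * (Module.finrank ℝ V + 2) : ℝ) * ∫ x, inner ℝ u x ^ 4 * w ‖x‖ ∂ν =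
      3 * ‖u‖ ^ 4 * ∫ x, ‖x‖ ^ 4 * w ‖x‖ ∂ν := by
  rcases eq_or_ne u 0 with rfl | hu0
  · simp
  let e : V := ‖u‖⁻¹ • u
  have he : ‖e‖ = 1 := by simp [e, norm_smul, hu0]
  have hue : u = ‖u‖ • e := by simp [e, smul_smul, hu0]
  have hscale : ∫ x, inner ℝ u x ^ 4 * w ‖x‖ ∂ν = ‖u‖ ^ 4 * ∫ x, inner ℝ e x ^ 4 * w ‖x‖ ∂ν := by
    rw [← integral_const_mul]
    congr 1; ext x
    conv_lhs => rw [hue, real_inner_smul_left]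
    ring
  let b := stdOrthonormalBasis ℝ V
  have hint2 : ∀ u v : V, Integrable (fun x ↦ inner ℝ u x ^ 2 * inner ℝ v x ^ 2 * w ‖x‖) ν :=
    fun u v ↦ integrable_mul_norm_of_bound hw hi
      (g := fun x ↦ inner ℝ u x ^ 2 * inner ℝ v x ^ 2) (by fun_prop)
      (abs_inner_sq_mul_inner_sq_le u v)
  set W := ∫ x, inner ℝ e x ^ 4 * w ‖x‖ ∂ν with hW
  have hWb : ∀ j, ∫ x, inner ℝ (b j) x ^ 4 * w ‖x‖ ∂ν = W := fun j ↦
    hν.integral_inner_pow_congr 4 w (by simp [he])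
  have hJ : ∀ i j, 3 * ∫ x, inner ℝ (b i) x ^ 2 * inner ℝ (b j) x ^ 2 * w ‖x‖ ∂ν =
      W + if i = j then 2 * W else 0 := by
    intro i j
    split_ifs with h
    · subst h
      rw [← hWb i, show (fun x ↦ inner ℝ (b i) x ^ 2 * inner ℝ (b i) x ^ 2 * w ‖x‖) =
        fun x ↦ inner ℝ (b i) x ^ 4 * w ‖x‖ by ext x; ring]
      ring
    · rw [hν.integral_inner_sq_mul_inner_sq hw hi (by simp) (by simp) (b.orthonormal.2 h), hWb,
        add_zero]
  have hsum : ∑ i, ∑ j, ∫ x, inner ℝ (b i) x ^ 2 * inner ℝ (b j) x ^ 2 * w ‖x‖ ∂ν =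
      ∫ x, ‖x‖ ^ 4 * w ‖x‖ ∂ν := by
    simp_rw [← integral_finsetSum _ fun j (_ : j ∈ Finset.univ) ↦ hint2 _ (b j)]
    rw [← integral_finsetSum _ fun i _ ↦ integrable_finsetSum _ fun j _ ↦ hint2 _ (b j)]
    congr 1; ext x
    simp_rw [← Finset.sum_mul, ← Finset.mul_sum, b.sum_sq_inner_right, ← Finset.sum_mul,
      b.sum_sq_inner_right]
    ring
  have := congrArg (3 * ·) hsum
  simp only [Finset.mul_sum, hJ] at this
  simp only [Finset.sum_add_distrib, Finset.sum_ite_eq, Finset.mem_univ, if_true,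
    Finset.sum_const, Finset.card_univ, Fintype.card_fin, nsmul_eq_mul] at this
  rw [hscale, mul_assoc 3, mul_left_comm 3, ← this]
  ring

end Isotropic

/-! ### Elementary inequalities for the exponential -/

lemma exp_neg_le_quadratic {y : ℝ} (hy : 0 ≤ y) : Real.exp (-y) ≤ 1 - y + y ^ 2 / 2 := by
  have h := Real.quadratic_le_exp_of_nonneg hy
  rw [Real.exp_neg, inv_le_comm₀ (Real.exp_pos y) (by nlinarith [sq_nonneg (y - 1)])]
  refine le_trans ?_ h
  rw [inv_le_comm₀ (by nlinarith [sq_nonneg (y - 1)]) (by positivity), inv_eq_one_div,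
    div_le_iff₀ (by positivity)]
  -- The two quadratics multiply to 1 + y⁴/4.
  nlinarith [sq_nonneg (y ^ 2)]

lemma exp_le_cubic_remainder {x : ℝ} (hx : 0 ≤ x) :
    Real.exp x ≤ 1 + x + x ^ 2 / 2 + x ^ 3 * Real.exp x / 6 := by
  have hd : ∀ y : ℝ, HasDerivAt (fun y ↦ (1 + y + y ^ 2 / 2) * Real.exp (-y) + y ^ 3 / 6)
      (y ^ 2 / 2 * (1 - Real.exp (-y))) y := by
    intro y
    have h1 : HasDerivAt (fun y : ℝ ↦ Real.exp (-y)) (-Real.exp (-y)) y := by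
      simpa using (hasDerivAt_neg y).exp
    have h2 : HasDerivAt (fun y : ℝ ↦ 1 + y + y ^ 2 / 2) (1 + y) y := by
      have := ((hasDerivAt_id y).const_add 1).add ((hasDerivAt_pow 2 y).div_const 2)
      convert! this using 1
      simp
    have h3 : HasDerivAt (fun y : ℝ ↦ y ^ 3 / 6) (y ^ 2 / 2) y := by
      convert! (hasDerivAt_pow 3 y).div_const 6 using 1
      simp; ring
    convert! (h2.mul h1).add h3 using 1
    ring
  -- At 0 this function equals 1; multiplying the resulting inequality by exp x gives the claim.
  have hm : MonotoneOn (fun y : ℝ ↦ (1 + y + y ^ 2 / 2) * Real.exp (-y) + y ^ 3 / 6)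
      (Set.Ici 0) := by
    refine monotoneOn_of_deriv_nonneg (convex_Ici 0)
      (fun y _ ↦ (hd y).continuousAt.continuousWithinAt)
      (fun y _ ↦ (hd y).differentiableAt.differentiableWithinAt) fun y hy ↦ ?_
    rw [(hd y).deriv]
    rw [interior_Ici, Set.mem_Ioi] at hy
    have : Real.exp (-y) ≤ 1 := Real.exp_le_one_iff.2 (by linarith)
    exact mul_nonneg (by positivity) (by linarith)
  have h := hm (Set.mem_Ici.2 le_rfl) (Set.mem_Ici.2 hx) hx
  simp only [add_zero, neg_zero, Real.exp_zero, mul_one, Real.exp_neg] at h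
  have h2 := mul_le_mul_of_nonneg_right h (Real.exp_pos x).le
  have hne := (Real.exp_pos x).ne'
  field_simp at h2 ⊢
  norm_num at h2
  linarith

/-- The point is the asymmetry: the nonnegative q enters only up to second order, and only b needs
an exponential moment. For the lower tail, q is the quadratic statistic and b the small compensator.
-/
lemma exp_sub_le {q b : ℝ} (hq : 0 ≤ q) (hb : 0 ≤ b) :
    Real.exp (b - q) ≤ 1 + (b - q) + (q ^ 2 + b ^ 2) / 2 + b ^ 3 * Real.exp b / 6 := by
  rcases le_total q b with h | h
  · have h1 := exp_le_cubic_remainder (sub_nonneg.2 h)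
    have h2 : (b - q) ^ 3 * Real.exp (b - q) ≤ b ^ 3 * Real.exp b := by
      have h3 : b - q ≤ b := by linarith
      have h4 : (0 : ℝ) ≤ b - q := by linarith
      gcongr
    nlinarith [mul_nonneg hq hb]
  · have h1 := exp_neg_le_quadratic (sub_nonneg.2 h)
    rw [neg_sub] at h1
    have : 0 ≤ b ^ 3 * Real.exp b := by positivity
    nlinarith [mul_nonneg hq hb]

/-- Absorbs the cubic remainder into exp(x²/4), which is integrable. The 90 is 9·10, from the
compensator bound s ≤ 1/9 and the scale 1/10 in the exponent. -/
lemma pow_three_mul_exp_le (x : ℝ) :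
    x ^ 3 * Real.exp (x / 90) ≤ 192 * Real.exp (x ^ 2 / 4) := by
  have h1 := Real.quadratic_le_exp_of_nonneg (x := x ^ 2 / 8) (by positivity)
  have h2 : x ^ 3 ≤ 64 * Real.exp (x ^ 2 / 8) := by
    nlinarith [sq_nonneg (x * (x - 1)), sq_nonneg x]
  have h3 : Real.exp (x / 90) ≤ 3 * Real.exp (x ^ 2 / 8) := by
    calc Real.exp (x / 90) ≤ Real.exp (1 + x ^ 2 / 8) := by
          apply Real.exp_le_exp.2; nlinarith [sq_nonneg (x - 1)]
      _ = Real.exp 1 * Real.exp (x ^ 2 / 8) := Real.exp_add _ _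
      _ ≤ _ := by gcongr; linarith [Real.exp_one_lt_d9]
  calc x ^ 3 * Real.exp (x / 90)
      ≤ (64 * Real.exp (x ^ 2 / 8)) * (3 * Real.exp (x ^ 2 / 8)) := by gcongr
    _ = 192 * (Real.exp (x ^ 2 / 8) * Real.exp (x ^ 2 / 8)) := by ring
    _ = _ := by rw [← Real.exp_add]; ring_nf

/-! ### Standard Gaussian vectors: the mean norm and the one-point lower-tail moment -/

section StdGaussian

set_option linter.unusedSectionVars false

variable {V : Type*} [NormedAddCommGroup V] [InnerProductSpace ℝ V] [FiniteDimensional ℝ V]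
  [MeasurableSpace V] [BorelSpace V]

lemma map_inner_stdGaussian {u : V} (hu : ‖u‖ = 1) :
    (stdGaussian V).map (fun x ↦ inner ℝ u x) = gaussianReal 0 1 := by
  have h := IsGaussian.map_eq_gaussianReal (μ := stdGaussian V) (innerSL ℝ u)
  rw [integral_strongDual_stdGaussian, variance_dual_stdGaussian, innerSL_apply_norm, hu] at h
  simpa using h

lemma integral_comp_inner_stdGaussian {u : V} (hu : ‖u‖ = 1) {f : ℝ → ℝ} (hf : Continuous f) :
    ∫ x, f (inner ℝ u x) ∂(stdGaussian V) = ∫ t, f t ∂(gaussianReal 0 1) := by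
  rw [← map_inner_stdGaussian hu, integral_map (by fun_prop) hf.aestronglyMeasurable]

lemma integrable_comp_inner_stdGaussian {u : V} (hu : ‖u‖ = 1) {f : ℝ → ℝ}
    (hf : Integrable f (gaussianReal 0 1)) :
    Integrable (fun x ↦ f (inner ℝ u x)) (stdGaussian V) := by
  rw [← map_inner_stdGaussian hu] at hf
  exact hf.comp_measurable (by fun_prop)

lemma integrable_norm_pow_stdGaussian (n : ℕ) :
    Integrable (fun x : V ↦ ‖x‖ ^ n) (stdGaussian V) :=
  (IsGaussian.memLp_id (stdGaussian V) n (by simp)).integrable_norm_pow'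

lemma integrable_norm_stdGaussian : Integrable (fun x : V ↦ ‖x‖) (stdGaussian V) := by
  simpa using integrable_norm_pow_stdGaussian (V := V) 1

lemma integral_sq_gaussianReal : ∫ x, x ^ 2 ∂(gaussianReal 0 1) = 1 := by
  have h := variance_fun_id_gaussianReal (μ := 0) (v := 1)
  rw [variance_of_integral_eq_zero (by fun_prop) integral_id_gaussianReal] at h
  simpa using h

lemma integral_norm_sq_stdGaussian :
    ∫ x, ‖x‖ ^ 2 ∂(stdGaussian V) = Module.finrank ℝ V := by
  rcases Nat.eq_zero_or_pos (Module.finrank ℝ V) with h0 | hpos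
  · have := Module.finrank_zero_iff.1 h0
    simp [h0, Subsingleton.elim _ (0 : V)]
  let b := stdOrthonormalBasis ℝ V
  have h := isIsotropic_stdGaussian.integral_inner_sq (V := V) (w := fun _ ↦ 1) (by fun_prop)
    (by simpa using integrable_norm_pow_stdGaussian (V := V) 2) (b ⟨0, hpos⟩)
  simp only [mul_one] at h
  rw [integral_comp_inner_stdGaussian (by simp) (f := fun t ↦ t ^ 2) (by fun_prop),
    integral_sq_gaussianReal] at h
  simpa using h.symm

lemma integral_norm_pow_four_stdGaussian :
    ∫ x, ‖x‖ ^ 4 ∂(stdGaussian V) = Module.finrank ℝ V * (Module.finrank ℝ V + 2) := by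
  rcases Nat.eq_zero_or_pos (Module.finrank ℝ V) with h0 | hpos
  · have := Module.finrank_zero_iff.1 h0
    simp [h0, Subsingleton.elim _ (0 : V)]
  let b := stdOrthonormalBasis ℝ V
  have h := isIsotropic_stdGaussian.integral_inner_pow_four (V := V) (w := fun _ ↦ 1)
    (by fun_prop) (by simpa using integrable_norm_pow_stdGaussian (V := V) 4) (b ⟨0, hpos⟩)
  simp only [mul_one] at h
  rw [integral_comp_inner_stdGaussian (by simp) (f := fun t ↦ t ^ 4) (by fun_prop),
    integral_pow_four_gaussianReal] at h
  simp at h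
  linarith

/-- Cauchy–Schwarz: the ℓ¹ norm is at most √d times the ℓ² norm. This bound on E‖g‖ is the better
one in low dimension. -/
lemma sqrt_two_div_pi_mul_sqrt_finrank_le :
    √(2 / Real.pi) * √(Module.finrank ℝ V) ≤ ∫ x, ‖x‖ ∂(stdGaussian V) := by
  let b := stdOrthonormalBasis ℝ V
  have hi : ∀ i, Integrable (fun x ↦ |inner ℝ (b i) x|) (stdGaussian V) := fun i ↦
    integrable_comp_inner_stdGaussian (by simp) (f := fun t ↦ |t|)
      (by simpa using integrable_abs_pow_mul_exp 1 (a := 0) (by norm_num))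
  have hv : ∀ i, ∫ x, |inner ℝ (b i) x| ∂(stdGaussian V) = √(2 / Real.pi) := fun i ↦ by
    rw [integral_comp_inner_stdGaussian (by simp) (f := fun t ↦ |t|) (by fun_prop),
      integral_abs_gaussianReal]
  have hle : ∫ x, ∑ i, |inner ℝ (b i) x| ∂(stdGaussian V) ≤
      ∫ x, √(Module.finrank ℝ V) * ‖x‖ ∂(stdGaussian V) := by
    refine integral_mono (integrable_finsetSum _ fun i _ ↦ hi i)
      (integrable_norm_stdGaussian.const_mul _) fun x ↦ ?_
    refine abs_le_of_sq_le_sq' ?_ (by positivity) |>.2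
    rw [mul_pow, Real.sq_sqrt (by positivity), ← b.sum_sq_inner_right x]
    have := sq_sum_le_card_mul_sum_sq (s := Finset.univ) (f := fun i ↦ |inner ℝ (b i) x|)
    simpa using this
  rw [integral_finsetSum _ fun i _ ↦ hi i, integral_const_mul] at hle
  simp only [hv, Finset.sum_const, Finset.card_univ, Fintype.card_fin, nsmul_eq_mul] at hle
  rcases Nat.eq_zero_or_pos (Module.finrank ℝ V) with h0 | hpos
  · simpa [h0] using integral_nonneg fun x ↦ norm_nonneg x
  have hs : 0 < √(Module.finrank ℝ V : ℝ) := by positivity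
  rw [← mul_le_mul_iff_right₀ hs]
  calc √(Module.finrank ℝ V : ℝ) * (√(2 / Real.pi) * √(Module.finrank ℝ V : ℝ))
      = (√(Module.finrank ℝ V : ℝ) * √(Module.finrank ℝ V : ℝ)) * √(2 / Real.pi) := by ring
    _ = Module.finrank ℝ V * √(2 / Real.pi) := by rw [Real.mul_self_sqrt (by positivity)]
    _ ≤ _ := hle

/-- With c = √(d + 2), the polynomial t(t - c)²(t + 2c) = t⁴ - 3c²t² + 2c³t is nonnegative for t ≥
0; taking expectations at t = ‖x‖ uses only the second and fourth moments. Unlike the previous bound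
it is asymptotically sharp as d grows. -/
lemma finrank_le_sqrt_mul_integral_norm :
    (Module.finrank ℝ V : ℝ) ≤ √(Module.finrank ℝ V + 2) * ∫ x, ‖x‖ ∂(stdGaussian V) := by
  set d : ℝ := (Module.finrank ℝ V : ℝ) with hd
  have hd0 : 0 ≤ d := by positivity
  have hs : √(d + 2) ^ 2 = d + 2 := Real.sq_sqrt (by positivity)
  have hle : ∫ x, (3 * (d + 2) * ‖x‖ ^ 2 - ‖x‖ ^ 4) ∂(stdGaussian V) ≤
      ∫ x, 2 * (d + 2) * √(d + 2) * ‖x‖ ∂(stdGaussian V) := by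
    refine integral_mono (((integrable_norm_pow_stdGaussian 2).const_mul _).sub
      (integrable_norm_pow_stdGaussian 4)) (integrable_norm_stdGaussian.const_mul _) fun x ↦ ?_
    have h1 : 0 ≤ ‖x‖ * (‖x‖ - √(d + 2)) ^ 2 * (‖x‖ + 2 * √(d + 2)) := by positivity
    linear_combination h1 - (3 * ‖x‖ ^ 2 - 2 * √(d + 2) * ‖x‖) * hs
  rw [integral_sub ((integrable_norm_pow_stdGaussian 2).const_mul _)
    (integrable_norm_pow_stdGaussian 4), integral_const_mul, integral_const_mul,
    integral_norm_sq_stdGaussian, integral_norm_pow_four_stdGaussian, ← hd] at hle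
  have h2 : (0 : ℝ) < 2 * (d + 2) := by positivity
  rw [← mul_le_mul_iff_right₀ h2]
  linarith

/-- ‖x‖²/d is the average of the squared coordinates, so Jensen reduces to one dimension and the
exponential moment is bounded independently of d. -/
lemma exp_norm_sq_div_le (hV : 0 < Module.finrank ℝ V) (x : V) :
    Real.exp ((‖x‖ / √(Module.finrank ℝ V)) ^ 2 / 4) ≤
      ∑ i, (Module.finrank ℝ V : ℝ)⁻¹ *
        Real.exp (inner ℝ (stdOrthonormalBasis ℝ V i) x ^ 2 / 4) := by
  have hd : (Module.finrank ℝ V : ℝ) ≠ 0 := by positivity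
  have h := convexOn_exp.map_sum_le (t := Finset.univ)
    (w := fun _ : Fin (Module.finrank ℝ V) ↦ (Module.finrank ℝ V : ℝ)⁻¹)
    (p := fun i ↦ inner ℝ (stdOrthonormalBasis ℝ V i) x ^ 2 / 4)
    (fun _ _ ↦ by positivity) (by simp [hd]) (by simp)
  simp only [smul_eq_mul] at h
  refine le_trans (le_of_eq ?_) h
  rw [← Finset.mul_sum, ← Finset.sum_div, (stdOrthonormalBasis ℝ V).sum_sq_inner_right, div_pow,
    Real.sq_sqrt (by positivity)]
  congr 1
  field_simp

lemma integrable_exp_inner_sq {u : V} (hu : ‖u‖ = 1) :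
    Integrable (fun x ↦ Real.exp (inner ℝ u x ^ 2 / 4)) (stdGaussian V) := by
  refine integrable_comp_inner_stdGaussian hu (f := fun t ↦ Real.exp (t ^ 2 / 4)) ?_
  refine (integrable_abs_pow_mul_exp 0 (a := 1 / 4) (by norm_num)).congr (ae_of_all _ fun x ↦ ?_)
  simp only [pow_zero, one_mul]
  congr 1; ring

lemma integrable_exp_norm_sq (hV : 0 < Module.finrank ℝ V) :
    Integrable (fun x : V ↦ Real.exp ((‖x‖ / √(Module.finrank ℝ V)) ^ 2 / 4))
      (stdGaussian V) := by
  refine (integrable_finsetSum Finset.univ fun i _ ↦ (integrable_exp_inner_sq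
    (u := stdOrthonormalBasis ℝ V i) (by simp)).const_mul
      (Module.finrank ℝ V : ℝ)⁻¹).mono' (by fun_prop) (ae_of_all _ fun x ↦ ?_)
  rw [Real.norm_of_nonneg (Real.exp_pos _).le]
  exact exp_norm_sq_div_le hV x

lemma integral_exp_norm_sq_le (hV : 0 < Module.finrank ℝ V) :
    ∫ x : V, Real.exp ((‖x‖ / √(Module.finrank ℝ V)) ^ 2 / 4) ∂(stdGaussian V) ≤ √2 := by
  have hi := fun i : Fin (Module.finrank ℝ V) ↦ (integrable_exp_inner_sq
    (u := stdOrthonormalBasis ℝ V i) (by simp)).const_mul (Module.finrank ℝ V : ℝ)⁻¹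
  have hd : (Module.finrank ℝ V : ℝ) ≠ 0 := by positivity
  refine (integral_mono (integrable_exp_norm_sq hV) (integrable_finsetSum Finset.univ
    fun i _ ↦ hi i) (exp_norm_sq_div_le hV)).trans (le_of_eq ?_)
  rw [integral_finsetSum _ fun i _ ↦ hi i]
  simp_rw [integral_const_mul]
  have : ∀ i, ∫ x, Real.exp (inner ℝ (stdOrthonormalBasis ℝ V i) x ^ 2 / 4) ∂(stdGaussian V) =
      √2 := fun i ↦ by
    rw [integral_comp_inner_stdGaussian (by simp) (f := fun t ↦ Real.exp (t ^ 2 / 4))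
      (by fun_prop), integral_exp_sq_div_four]
  simp [this, hd]

lemma integral_inner_sq_div_norm (θ : V) :
    Module.finrank ℝ V * ∫ x, inner ℝ θ x ^ 2 / ‖x‖ ∂(stdGaussian V) =
      ‖θ‖ ^ 2 * ∫ x, ‖x‖ ∂(stdGaussian V) := by
  have he : (fun x : V ↦ ‖x‖ ^ 2 * ‖x‖⁻¹) = fun x ↦ ‖x‖ := by
    ext x
    rcases eq_or_ne ‖x‖ 0 with h | h
    · simp [h]
    · field_simp
  have h := isIsotropic_stdGaussian.integral_inner_sq (V := V) (w := fun t ↦ t⁻¹) (by fun_prop)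
    (by simpa only [he] using integrable_norm_stdGaussian) θ
  rw [he] at h
  simpa only [div_eq_mul_inv] using h

lemma integral_inner_pow_four_div_norm_sq (hV : 0 < Module.finrank ℝ V) (θ : V) :
    (Module.finrank ℝ V + 2) * ∫ x, inner ℝ θ x ^ 4 / ‖x‖ ^ 2 ∂(stdGaussian V) =
      3 * ‖θ‖ ^ 4 := by
  have he : (fun x : V ↦ ‖x‖ ^ 4 * (‖x‖ ^ 2)⁻¹) = fun x ↦ ‖x‖ ^ 2 := by
    ext x
    rcases eq_or_ne ‖x‖ 0 with h | h
    · simp [h]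
    · field_simp
  have h := isIsotropic_stdGaussian.integral_inner_pow_four (V := V) (w := fun t ↦ (t ^ 2)⁻¹)
    (by fun_prop) (by simpa only [he] using integrable_norm_pow_stdGaussian 2) θ
  rw [he, integral_norm_sq_stdGaussian] at h
  have hd : (Module.finrank ℝ V : ℝ) ≠ 0 := by positivity
  apply mul_left_cancel₀ hd
  simp only [div_eq_mul_inv]
  linarith

lemma integrable_inner_sq_div_norm (θ : V) :
    Integrable (fun x ↦ inner ℝ θ x ^ 2 / ‖x‖) (stdGaussian V) := by
  refine (integrable_norm_stdGaussian.const_mul (‖θ‖ ^ 2)).mono'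
    (Measurable.aestronglyMeasurable (by fun_prop)) (ae_of_all _ fun x ↦ ?_)
  rw [Real.norm_of_nonneg (by positivity)]
  rcases eq_or_ne ‖x‖ 0 with h | h
  · simp [h]
  rw [div_le_iff₀ (by positivity)]
  have := abs_real_inner_le_norm θ x
  calc inner ℝ θ x ^ 2 = |inner ℝ θ x| ^ 2 := (sq_abs _).symm
    _ ≤ (‖θ‖ * ‖x‖) ^ 2 := by gcongr
    _ = _ := by ring

lemma integrable_inner_pow_four_div_norm_sq (θ : V) :
    Integrable (fun x ↦ inner ℝ θ x ^ 4 / ‖x‖ ^ 2) (stdGaussian V) := by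
  refine ((integrable_norm_pow_stdGaussian 2).const_mul (‖θ‖ ^ 4)).mono'
    (Measurable.aestronglyMeasurable (by fun_prop)) (ae_of_all _ fun x ↦ ?_)
  rw [Real.norm_of_nonneg (by positivity)]
  rcases eq_or_ne ‖x‖ 0 with h | h
  · simp [h]
  rw [div_le_iff₀ (by positivity)]
  have := abs_real_inner_le_norm θ x
  calc inner ℝ θ x ^ 4 = |inner ℝ θ x| ^ 4 := ((show Even 4 by decide).pow_abs _).symm
    _ ≤ (‖θ‖ * ‖x‖) ^ 4 := by gcongr
    _ = _ := by ring

/-- The functional `√d ⟪θ, x⟫² / ‖x‖ - (s / √d) ‖x‖`, whose average over `θ` in a ball with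
center `u` and mean squared radius `s` is `√d ⟪u, x⟫² / ‖x‖`. -/
def centeredQuadratic (s : ℝ) (θ x : V) : ℝ :=
  √(Module.finrank ℝ V) * (inner ℝ θ x ^ 2 / ‖x‖) - s * (‖x‖ / √(Module.finrank ℝ V))

/-- The normalized mean norm `E‖g‖ / √d` of a standard Gaussian vector. -/
def meanNorm (V : Type*) [NormedAddCommGroup V] [InnerProductSpace ℝ V] [FiniteDimensional ℝ V]
    [MeasurableSpace V] : ℝ :=
  (∫ x, ‖x‖ ∂(stdGaussian V)) / √(Module.finrank ℝ V)

lemma exp_neg_centeredQuadratic_le {s : ℝ} (hs0 : 0 ≤ s) (hs : s ≤ 1 / 9) (θ x : V) :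
    Real.exp (-(centeredQuadratic s θ x / 10)) ≤
      1 + (s * (‖x‖ / √(Module.finrank ℝ V)) -
          √(Module.finrank ℝ V) * (inner ℝ θ x ^ 2 / ‖x‖)) / 10 +
        (Module.finrank ℝ V * (inner ℝ θ x ^ 4 / ‖x‖ ^ 2) +
          s ^ 2 * ((Module.finrank ℝ V : ℝ)⁻¹ * ‖x‖ ^ 2)) / 200 +
        192 / (6 * 90 ^ 3) * Real.exp ((‖x‖ / √(Module.finrank ℝ V)) ^ 2 / 4) := by
  set d : ℝ := (Module.finrank ℝ V : ℝ) with hd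
  have hd0 : 0 ≤ d := by positivity
  set ρ := ‖x‖ / √d with hρ
  have hρ0 : 0 ≤ ρ := by positivity
  have h := exp_sub_le (q := √d * (inner ℝ θ x ^ 2 / ‖x‖) / 10) (b := s * ρ / 10)
    (by positivity) (by positivity)
  have h1 : (√d * (inner ℝ θ x ^ 2 / ‖x‖) / 10) ^ 2 = d * (inner ℝ θ x ^ 4 / ‖x‖ ^ 2) / 100 := by
    rw [div_pow, mul_pow, Real.sq_sqrt hd0, div_pow]; ring
  have h2 : (s * ρ / 10) ^ 2 = s ^ 2 * (d⁻¹ * ‖x‖ ^ 2) / 100 := by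
    rw [hρ, div_pow, mul_pow, div_pow, Real.sq_sqrt hd0]; ring
  have h3 : (s * ρ / 10) ^ 3 * Real.exp (s * ρ / 10) / 6 ≤
      192 / (6 * 90 ^ 3) * Real.exp (ρ ^ 2 / 4) := by
    have h4 : s * ρ / 10 ≤ ρ / 90 := by nlinarith
    have h5 := pow_three_mul_exp_le ρ
    calc (s * ρ / 10) ^ 3 * Real.exp (s * ρ / 10) / 6
        ≤ (ρ / 90) ^ 3 * Real.exp (ρ / 90) / 6 := by gcongr
      _ = (ρ ^ 3 * Real.exp (ρ / 90)) / (6 * 90 ^ 3) := by ring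
      _ ≤ (192 * Real.exp (ρ ^ 2 / 4)) / (6 * 90 ^ 3) := by gcongr
      _ = _ := by ring
  rw [h1, h2] at h
  have h6 : -(centeredQuadratic s θ x / 10) =
      s * ρ / 10 - √d * (inner ℝ θ x ^ 2 / ‖x‖) / 10 := by
    rw [centeredQuadratic, ← hd, ← hρ]; ring
  rw [h6]
  linarith

/-- Termwise integration of the preceding pointwise bound: the first-order term produces `meanNorm`,
the second-order term the isotropic fourth moment. The cubic remainder is at most 192·√2/(6·90³) <
1/10000. -/
lemma integrable_exp_neg_centeredQuadratic (hV : 0 < Module.finrank ℝ V) {s : ℝ} (hs0 : 0 ≤ s)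
    (hs : s ≤ 1 / 9) (θ : V) :
    Integrable (fun x ↦ Real.exp (-(centeredQuadratic s θ x / 10))) (stdGaussian V) ∧
    ∫ x, Real.exp (-(centeredQuadratic s θ x / 10)) ∂(stdGaussian V) ≤
      1 - (meanNorm V * (‖θ‖ ^ 2 - s) / 10 -
        (3 * Module.finrank ℝ V / (Module.finrank ℝ V + 2) * ‖θ‖ ^ 4 + s ^ 2) / 200 -
        1 / 10000) := by
  set d : ℝ := (Module.finrank ℝ V : ℝ) with hd
  have hdpos : 0 < d := by positivity
  have hsd : √d * √d = d := Real.mul_self_sqrt hdpos.le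
  have hsd0 : √d ≠ 0 := by positivity
  have i1 : Integrable (fun x : V ↦ s * (‖x‖ / √d)) (stdGaussian V) :=
    (integrable_norm_stdGaussian.div_const _).const_mul s
  have i2 : Integrable (fun x : V ↦ √d * (inner ℝ θ x ^ 2 / ‖x‖)) (stdGaussian V) :=
    (integrable_inner_sq_div_norm θ).const_mul _
  have i3 : Integrable (fun x : V ↦ d * (inner ℝ θ x ^ 4 / ‖x‖ ^ 2)) (stdGaussian V) :=
    (integrable_inner_pow_four_div_norm_sq θ).const_mul _
  have i4 : Integrable (fun x : V ↦ s ^ 2 * (d⁻¹ * ‖x‖ ^ 2)) (stdGaussian V) :=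
    ((integrable_norm_pow_stdGaussian 2).const_mul _).const_mul _
  have i5 : Integrable (fun x : V ↦ 192 / (6 * 90 ^ 3) * Real.exp ((‖x‖ / √d) ^ 2 / 4))
      (stdGaussian V) := (integrable_exp_norm_sq hV).const_mul _
  have j1 : Integrable (fun x : V ↦ (s * (‖x‖ / √d) - √d * (inner ℝ θ x ^ 2 / ‖x‖)) / 10)
      (stdGaussian V) := (i1.sub i2).div_const _
  have j2 : Integrable (fun x : V ↦ (d * (inner ℝ θ x ^ 4 / ‖x‖ ^ 2) +
      s ^ 2 * (d⁻¹ * ‖x‖ ^ 2)) / 200) (stdGaussian V) := (i3.add i4).div_const _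
  have j3 : Integrable (fun x : V ↦ 1 + (s * (‖x‖ / √d) - √d * (inner ℝ θ x ^ 2 / ‖x‖)) / 10)
      (stdGaussian V) := (integrable_const 1).add j1
  have j4 : Integrable (fun x : V ↦ 1 + (s * (‖x‖ / √d) - √d * (inner ℝ θ x ^ 2 / ‖x‖)) / 10 +
      (d * (inner ℝ θ x ^ 4 / ‖x‖ ^ 2) + s ^ 2 * (d⁻¹ * ‖x‖ ^ 2)) / 200) (stdGaussian V) :=
    j3.add j2
  have hbound := fun x ↦ exp_neg_centeredQuadratic_le hs0 hs θ x
  rw [← hd] at hbound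
  have hint : Integrable (fun x ↦ Real.exp (-(centeredQuadratic s θ x / 10))) (stdGaussian V) := by
    refine (j4.add i5).mono' (Measurable.aestronglyMeasurable ?_) (ae_of_all _ fun x ↦ ?_)
    · unfold centeredQuadratic; fun_prop
    · rw [Real.norm_of_nonneg (Real.exp_pos _).le]
      exact hbound x
  refine ⟨hint, (integral_mono hint (j4.add i5) hbound).trans ?_⟩
  have e : ∫ x, (1 + (s * (‖x‖ / √d) - √d * (inner ℝ θ x ^ 2 / ‖x‖)) / 10 +
      (d * (inner ℝ θ x ^ 4 / ‖x‖ ^ 2) + s ^ 2 * (d⁻¹ * ‖x‖ ^ 2)) / 200 +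
      192 / (6 * 90 ^ 3) * Real.exp ((‖x‖ / √d) ^ 2 / 4)) ∂(stdGaussian V) =
      1 + (s * ((∫ x, ‖x‖ ∂(stdGaussian V)) / √d) -
        √d * ∫ x, inner ℝ θ x ^ 2 / ‖x‖ ∂(stdGaussian V)) / 10 +
      (d * ∫ x, inner ℝ θ x ^ 4 / ‖x‖ ^ 2 ∂(stdGaussian V) +
        s ^ 2 * (d⁻¹ * ∫ x, ‖x‖ ^ 2 ∂(stdGaussian V))) / 200 +
      192 / (6 * 90 ^ 3) * ∫ x : V, Real.exp ((‖x‖ / √d) ^ 2 / 4) ∂(stdGaussian V) := by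
    rw [integral_add j4 i5, integral_add j3 j2, integral_add (integrable_const 1) j1,
      integral_div, integral_div, integral_sub i1 i2, integral_add i3 i4, integral_const_mul,
      integral_const_mul, integral_const_mul, integral_const_mul, integral_const_mul,
      integral_const_mul, integral_div]
    simp
  refine (le_of_eq e).trans ?_
  have e2 := integral_inner_sq_div_norm θ
  have e4 := integral_inner_pow_four_div_norm_sq hV θ
  have e5 := integral_exp_norm_sq_le (V := V) hV
  rw [← hd] at e2 e4 e5
  have f2 : √d * ∫ x, inner ℝ θ x ^ 2 / ‖x‖ ∂(stdGaussian V) = ‖θ‖ ^ 2 * meanNorm V := by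
    rw [meanNorm, ← hd, ← mul_div_assoc, ← e2, eq_div_iff hsd0]
    nth_rewrite 3 [← hsd]
    ring
  have f4 : d * ∫ x, inner ℝ θ x ^ 4 / ‖x‖ ^ 2 ∂(stdGaussian V) =
      3 * d / (d + 2) * ‖θ‖ ^ 4 := by
    rw [div_mul_eq_mul_div, eq_div_iff (by positivity)]
    linear_combination d * e4
  have f3 : d⁻¹ * ∫ x, ‖x‖ ^ 2 ∂(stdGaussian V) = 1 := by
    rw [integral_norm_sq_stdGaussian, ← hd, inv_mul_cancel₀ hdpos.ne']
  have f1 : (∫ x, ‖x‖ ∂(stdGaussian V)) / √d = meanNorm V := rfl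
  rw [f1, f2, f3, f4]
  have h2 : √2 ≤ (1.5 : ℝ) := Real.sqrt_le_iff.2 ⟨by norm_num, by norm_num⟩
  nlinarith

lemma sqrt_two_div_pi_le_meanNorm (hV : 0 < Module.finrank ℝ V) :
    √(2 / Real.pi) ≤ meanNorm V := by
  rw [meanNorm, le_div_iff₀ (by positivity)]
  exact sqrt_two_div_pi_mul_sqrt_finrank_le

lemma sqrt_finrank_div_le_meanNorm :
    √(Module.finrank ℝ V / (Module.finrank ℝ V + 2)) ≤ meanNorm V := by
  rcases Nat.eq_zero_or_pos (Module.finrank ℝ V) with h0 | hpos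
  · simp [h0, meanNorm]
  rw [meanNorm, le_div_iff₀ (by positivity), Real.sqrt_div (by positivity), div_mul_eq_mul_div,
    Real.mul_self_sqrt (by positivity), div_le_iff₀ (by positivity), mul_comm]
  exact finrank_le_sqrt_mul_integral_norm

end StdGaussian

/-! ### Uniform deviation bounds by averaging over balls -/

section Smoothing

set_option linter.unusedSectionVars false

variable {V : Type*} [NormedAddCommGroup V] [InnerProductSpace ℝ V] [FiniteDimensional ℝ V]
  [MeasurableSpace V] [BorelSpace V]

lemma integrableOn_ball_of_continuous {f : V → ℝ} (hf : Continuous f) (u : V) (r : ℝ) :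
    IntegrableOn f (Metric.ball u r) :=
  (hf.continuousOn.integrableOn_compact (isCompact_closedBall u r)).mono_set
    Metric.ball_subset_closedBall

/-- Jensen in tangent-line form: exp f ≥ eᵗ(1 + f - t), integrated over the ball. -/
lemma exp_mul_volume_ball_le {f : V → ℝ} (hf : Continuous f) {u : V} {r t : ℝ}
    (h : t * volume.real (Metric.ball u r) ≤ ∫ θ in Metric.ball u r, f θ) :
    ENNReal.ofReal (Real.exp t) * volume (Metric.ball u r) ≤
      ∫⁻ θ in Metric.ball u r, ENNReal.ofReal (Real.exp (f θ)) := by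
  have hi := integrableOn_ball_of_continuous hf u r
  have hie := integrableOn_ball_of_continuous (f := fun θ ↦ Real.exp (f θ)) (by fun_prop) u r
  have hic : IntegrableOn (fun _ : V ↦ 1 - t) (Metric.ball u r) :=
    integrableOn_ball_of_continuous continuous_const u r
  rw [← ofReal_integral_eq_lintegral_ofReal hie (ae_of_all _ fun θ ↦ (Real.exp_pos _).le),
    ← ENNReal.ofReal_toReal (measure_ball_lt_top (μ := (volume : Measure V))).ne,
    ← ENNReal.ofReal_mul (Real.exp_pos t).le]
  apply ENNReal.ofReal_le_ofReal
  have h1 : ∫ θ in Metric.ball u r, Real.exp t * ((1 - t) + f θ) ≤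
      ∫ θ in Metric.ball u r, Real.exp (f θ) := by
    refine integral_mono ((hic.add hi).const_mul _) hie fun θ ↦ ?_
    have h2 := Real.add_one_le_exp (f θ - t)
    calc Real.exp t * ((1 - t) + f θ) ≤ Real.exp t * Real.exp (f θ - t) := by
          gcongr; linarith
      _ = Real.exp (f θ) := by rw [← Real.exp_add]; ring_nf
  rw [integral_const_mul, integral_add hic hi, setIntegral_const, smul_eq_mul] at h1
  refine le_trans ?_ h1
  change Real.exp t * volume.real _ ≤ _
  gcongr
  linarith

/-- The integral Z of exp Φ over the ball of radius 1 + r does not depend on u and has mean at most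
the volume of that ball. Any offending u forces Z ≥ eᵗ·vol(B(u, r)), so a single application of
Markov's inequality handles all unit vectors at once; the volume ratio is the entropy cost. -/
lemma measure_exists_setIntegral_ball_ge_le {Ω : Type*} [MeasurableSpace Ω] {P : Measure Ω}
    [IsProbabilityMeasure P] {Φ : V → Ω → ℝ} {r : ℝ} (hr : 0 < r)
    (hmeas : Measurable (Function.uncurry Φ)) (hcont : ∀ ω, Continuous fun θ ↦ Φ θ ω)
    (hexp : ∀ θ, ‖θ‖ < 1 + r → ∫⁻ ω, ENNReal.ofReal (Real.exp (Φ θ ω)) ∂P ≤ 1) (t : ℝ) :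
    P {ω | ∃ u : V, ‖u‖ = 1 ∧
        t * volume.real (Metric.ball u r) ≤ ∫ θ in Metric.ball u r, Φ θ ω} ≤
      ENNReal.ofReal (((1 + r) / r) ^ Module.finrank ℝ V * Real.exp (-t)) := by
  let Z : Ω → ENNReal := fun ω ↦
    ∫⁻ θ in Metric.ball (0 : V) (1 + r), ENNReal.ofReal (Real.exp (Φ θ ω))
  have hm : Measurable (Function.uncurry fun ω θ ↦ ENNReal.ofReal (Real.exp (Φ θ ω))) :=
    (Real.measurable_exp.comp (hmeas.comp measurable_swap)).ennreal_ofReal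
  have hZm : Measurable Z := hm.lintegral_prod_right'
  have hZ : ∫⁻ ω, Z ω ∂P ≤ volume (Metric.ball (0 : V) (1 + r)) := by
    rw [lintegral_lintegral_swap hm.aemeasurable]
    calc ∫⁻ θ in Metric.ball (0 : V) (1 + r), ∫⁻ ω, ENNReal.ofReal (Real.exp (Φ θ ω)) ∂P
        ≤ ∫⁻ θ in Metric.ball (0 : V) (1 + r), 1 :=
          setLIntegral_mono measurable_const fun θ hθ ↦ hexp θ (by simpa using hθ)
      _ = _ := by simp
  have hpos : volume (Metric.ball (0 : V) 1) ≠ 0 := (Metric.measure_ball_pos _ _ one_pos).ne'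
  have hfin : volume (Metric.ball (0 : V) 1) ≠ ⊤ := measure_ball_lt_top.ne
  set c := ENNReal.ofReal (Real.exp t) * volume (Metric.ball (0 : V) r) with hc
  have hsub : {ω | ∃ u : V, ‖u‖ = 1 ∧
      t * volume.real (Metric.ball u r) ≤ ∫ θ in Metric.ball u r, Φ θ ω} ⊆ {ω | c ≤ Z ω} := by
    rintro ω ⟨u, hu, h⟩
    have h1 := exp_mul_volume_ball_le (hcont ω) h
    rw [Measure.addHaar_ball_center] at h1
    refine h1.trans (lintegral_mono_set fun θ hθ ↦ ?_)
    rw [Metric.mem_ball, dist_eq_norm] at hθ ⊢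
    calc ‖θ - 0‖ = ‖u + (θ - u)‖ := by simp
      _ ≤ ‖u‖ + ‖θ - u‖ := norm_add_le _ _
      _ < 1 + r := by rw [hu]; linarith
  refine (measure_mono hsub).trans ?_
  have hmarkov := (mul_meas_ge_le_lintegral₀ hZm.aemeasurable c).trans hZ
  have hc2 : c = volume (Metric.ball (0 : V) 1) *
      ENNReal.ofReal (Real.exp t * r ^ Module.finrank ℝ V) := by
    rw [hc, Measure.addHaar_ball_of_pos _ _ hr, ← mul_assoc,
      ← ENNReal.ofReal_mul (Real.exp_pos t).le, mul_comm]
  generalize P {ω | c ≤ Z ω} = p at hmarkov ⊢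
  rw [hc2, Measure.addHaar_ball_of_pos _ _ (by linarith : 0 < 1 + r), mul_assoc,
    mul_comm (ENNReal.ofReal ((1 + r) ^ _)), ENNReal.mul_le_mul_iff_right hpos hfin,
    mul_comm] at hmarkov
  have hk : 0 < Real.exp t * r ^ Module.finrank ℝ V := by positivity
  rw [← ENNReal.le_div_iff_mul_le (Or.inl (by simpa using hk)) (Or.inl ENNReal.ofReal_ne_top),
    ← ENNReal.ofReal_div_of_pos hk] at hmarkov
  refine hmarkov.trans (le_of_eq ?_)
  congr 1
  rw [Real.exp_neg, div_pow]
  field_simp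

lemma setIntegral_ball_translate (u : V) (r : ℝ) (f : V → ℝ) :
    ∫ θ in Metric.ball u r, f θ = ∫ ξ in Metric.ball (0 : V) r, f (u + ξ) := by
  have h := (measurePreserving_add_left (volume : Measure V) u).setIntegral_preimage_emb
    (measurableEmbedding_addLeft u) f (Metric.ball u r)
  rw [← h]
  congr 2
  ext x
  simp [dist_eq_norm]

lemma setIntegral_ball_of_odd {r : ℝ} {f : V → ℝ} (hf : ∀ x, f (-x) = -f x) :
    ∫ ξ in Metric.ball (0 : V) r, f ξ = 0 := by
  have h := (isIsotropic_volume_restrict_ball (V := V) r).integral_comp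
    (LinearIsometryEquiv.neg ℝ) f
  simp only [LinearIsometryEquiv.coe_neg, hf, integral_neg] at h
  linarith

/-- The mean squared norm of a uniform point of a ball of radius `r` in dimension `d`. -/
def ballSecondMoment (V : Type*) [NormedAddCommGroup V] [InnerProductSpace ℝ V] (r : ℝ) : ℝ :=
  r ^ 2 * Module.finrank ℝ V / (Module.finrank ℝ V + 2)

lemma setIntegral_ball_norm_sq {r : ℝ} (hr : 0 < r) :
    ∫ ξ in Metric.ball (0 : V) r, ‖ξ‖ ^ 2 =
      volume.real (Metric.ball (0 : V) r) * ballSecondMoment V r := by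
  rcases Nat.eq_zero_or_pos (Module.finrank ℝ V) with h0 | hpos
  · have := Module.finrank_zero_iff.1 h0
    simp [h0, Subsingleton.elim _ (0 : V), ballSecondMoment]
  have : Nontrivial V := Module.finrank_pos_iff.1 hpos
  have h := integral_fun_norm_addHaar (volume : Measure V)
    (fun t ↦ (Set.Iio r).indicator (fun t ↦ t ^ 2) t)
  have h1 : (fun x : V ↦ (Set.Iio r).indicator (fun t ↦ t ^ 2) ‖x‖) =
      (Metric.ball (0 : V) r).indicator fun x ↦ ‖x‖ ^ 2 := by
    ext x
    by_cases hx : ‖x‖ < r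
    · rw [Set.indicator_of_mem (Set.mem_Iio.2 hx), Set.indicator_of_mem (mem_ball_zero_iff.2 hx)]
    · rw [Set.indicator_of_notMem (fun h ↦ hx (Set.mem_Iio.1 h)),
        Set.indicator_of_notMem (fun h ↦ hx (mem_ball_zero_iff.1 h))]
  rw [h1, integral_indicator measurableSet_ball] at h
  rw [h]
  have h2 : ∀ y : ℝ, y ^ (Module.finrank ℝ V - 1) • (Set.Iio r).indicator (fun t ↦ t ^ 2) y =
      (Set.Iio r).indicator (fun t ↦ t ^ (Module.finrank ℝ V + 1)) y := by
    intro y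
    by_cases hy : y < r
    · simp only [Set.indicator_of_mem (Set.mem_Iio.2 hy), smul_eq_mul]
      rw [← pow_add]; congr 1; omega
    · simp [hy]
  simp_rw [h2]
  rw [setIntegral_indicator measurableSet_Iio, Set.Ioi_inter_Iio,
    ← integral_Ioc_eq_integral_Ioo, ← intervalIntegral.integral_of_le hr.le, integral_pow]
  have h3 : volume.real (Metric.ball (0 : V) r) =
      r ^ Module.finrank ℝ V * volume.real (Metric.ball (0 : V) 1) := by
    rw [measureReal_def, Measure.addHaar_ball _ _ hr.le, ENNReal.toReal_mul,
      ENNReal.toReal_ofReal (by positivity)]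
    rfl
  rw [h3, ballSecondMoment]
  simp only [nsmul_eq_mul, smul_eq_mul]
  push_cast
  rw [show (Module.finrank ℝ V : ℝ) + 1 + 1 = Module.finrank ℝ V + 2 by ring]
  field_simp
  ring

lemma setIntegral_ball_inner_sq {r : ℝ} (hr : 0 < r) (y : V) :
    ∫ ξ in Metric.ball (0 : V) r, inner ℝ y ξ ^ 2 =
      volume.real (Metric.ball (0 : V) r) *
        (ballSecondMoment V r / Module.finrank ℝ V * ‖y‖ ^ 2) := by
  rcases Nat.eq_zero_or_pos (Module.finrank ℝ V) with h0 | hpos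
  · have := Module.finrank_zero_iff.1 h0
    simp [Subsingleton.elim _ (0 : V)]
  have h := (isIsotropic_volume_restrict_ball (V := V) r).integral_inner_sq (w := fun _ ↦ 1)
    (by fun_prop) (integrableOn_ball_of_continuous (by fun_prop) _ _) y
  simp only [mul_one] at h
  rw [setIntegral_ball_norm_sq hr] at h
  field_simp
  linarith

/-- The average of ⟨θ, y⟩ over the ball is ⟨u, y⟩, and passing to absolute values only increases an
average. For outlier upper tails smoothing is therefore free. -/
lemma abs_inner_le_setIntegral_ball (u y : V) (r : ℝ) :
    |inner ℝ u y| * volume.real (Metric.ball u r) ≤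
      ∫ θ in Metric.ball u r, |inner ℝ θ y| := by
  have h0 : ∫ θ in Metric.ball u r, inner ℝ θ y =
      inner ℝ u y * volume.real (Metric.ball u r) := by
    have hc : IntegrableOn (fun _ : V ↦ inner ℝ u y) (Metric.ball (0 : V) r) :=
      integrableOn_ball_of_continuous continuous_const _ _
    have hi : IntegrableOn (fun ξ : V ↦ inner ℝ ξ y) (Metric.ball (0 : V) r) :=
      integrableOn_ball_of_continuous (by fun_prop) _ _
    rw [setIntegral_ball_translate]
    simp_rw [inner_add_left]
    rw [integral_add hc hi, setIntegral_ball_of_odd (f := fun ξ ↦ inner ℝ ξ y) (by simp),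
      setIntegral_const, smul_eq_mul, add_zero, mul_comm, measureReal_def, measureReal_def,
      Measure.addHaar_ball_center _ u]
  have h1 := abs_integral_le_integral_abs (μ := volume.restrict (Metric.ball u r))
    (f := fun θ ↦ inner ℝ θ y)
  rwa [h0, abs_mul, abs_of_nonneg (measureReal_nonneg (μ := volume) (s := Metric.ball u r))] at h1

/-- The cross term is odd and vanishes. The extra multiple of ‖y‖² is the smoothing bias that
`centeredQuadratic` subtracts. -/
lemma setIntegral_ball_inner_sq_center {r : ℝ} (hr : 0 < r) (u y : V) :
    ∫ θ in Metric.ball u r, inner ℝ θ y ^ 2 =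
      volume.real (Metric.ball u r) *
        (inner ℝ u y ^ 2 + ballSecondMoment V r / Module.finrank ℝ V * ‖y‖ ^ 2) := by
  have hc : IntegrableOn (fun _ : V ↦ inner ℝ u y ^ 2) (Metric.ball (0 : V) r) :=
    integrableOn_ball_of_continuous continuous_const _ _
  have hi : IntegrableOn (fun ξ : V ↦ 2 * inner ℝ u y * inner ℝ y ξ) (Metric.ball (0 : V) r) :=
    integrableOn_ball_of_continuous (by fun_prop) _ _
  have hs : IntegrableOn (fun ξ : V ↦ inner ℝ y ξ ^ 2) (Metric.ball (0 : V) r) :=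
    integrableOn_ball_of_continuous (by fun_prop) _ _
  have hcs : IntegrableOn (fun ξ : V ↦ inner ℝ u y ^ 2 + inner ℝ y ξ ^ 2)
    (Metric.ball (0 : V) r) := hc.add hs
  rw [setIntegral_ball_translate]
  have he : ∀ ξ : V, inner ℝ (u + ξ) y ^ 2 =
      inner ℝ u y ^ 2 + inner ℝ y ξ ^ 2 + 2 * inner ℝ u y * inner ℝ y ξ := by
    intro ξ; rw [inner_add_left, real_inner_comm ξ y]; ring
  simp_rw [he]
  rw [integral_add hcs hi, integral_add hc hs,
    setIntegral_ball_of_odd (f := fun ξ ↦ 2 * inner ℝ u y * inner ℝ y ξ) (by simp),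
    setIntegral_ball_inner_sq hr, setIntegral_const, smul_eq_mul, measureReal_def,
    measureReal_def, Measure.addHaar_ball_center _ u]
  ring

lemma setIntegral_ball_norm_sq_center {r : ℝ} (hr : 0 < r) (u : V) :
    ∫ θ in Metric.ball u r, ‖θ‖ ^ 2 =
      volume.real (Metric.ball u r) * (‖u‖ ^ 2 + ballSecondMoment V r) := by
  have hc : IntegrableOn (fun _ : V ↦ ‖u‖ ^ 2) (Metric.ball (0 : V) r) :=
    integrableOn_ball_of_continuous continuous_const _ _
  have hi : IntegrableOn (fun ξ : V ↦ 2 * inner ℝ u ξ) (Metric.ball (0 : V) r) :=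
    integrableOn_ball_of_continuous (by fun_prop) _ _
  have hs : IntegrableOn (fun ξ : V ↦ ‖ξ‖ ^ 2) (Metric.ball (0 : V) r) :=
    integrableOn_ball_of_continuous (by fun_prop) _ _
  have hci : IntegrableOn (fun ξ : V ↦ ‖u‖ ^ 2 + 2 * inner ℝ u ξ)
    (Metric.ball (0 : V) r) := hc.add hi
  rw [setIntegral_ball_translate]
  simp_rw [norm_add_sq_real]
  rw [integral_add hci hs, integral_add hc hi,
    setIntegral_ball_of_odd (f := fun ξ ↦ 2 * inner ℝ u ξ) (by simp),
    setIntegral_ball_norm_sq hr, setIntegral_const, smul_eq_mul, measureReal_def,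
    measureReal_def, Measure.addHaar_ball_center _ u]
  ring

lemma setIntegral_ball_norm_pow_four_le {r : ℝ} (hr : 0 < r) (hV : 0 < Module.finrank ℝ V)
    {u : V} (hu : ‖u‖ = 1) :
    ∫ θ in Metric.ball u r, ‖θ‖ ^ 4 ≤ volume.real (Metric.ball u r) * (1 + r ^ 2) ^ 2 := by
  have hc : IntegrableOn (fun _ : V ↦ (1 : ℝ)) (Metric.ball (0 : V) r) :=
    integrableOn_ball_of_continuous continuous_const _ _
  have h1 : IntegrableOn (fun ξ : V ↦ (2 + r ^ 2) * ‖ξ‖ ^ 2) (Metric.ball (0 : V) r) :=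
    integrableOn_ball_of_continuous (by fun_prop) _ _
  have h2 : IntegrableOn (fun ξ : V ↦ 4 * inner ℝ u ξ ^ 2) (Metric.ball (0 : V) r) :=
    integrableOn_ball_of_continuous (by fun_prop) _ _
  have h3 : IntegrableOn (fun ξ : V ↦ 4 * inner ℝ u ξ * (1 + ‖ξ‖ ^ 2)) (Metric.ball (0 : V) r) :=
    integrableOn_ball_of_continuous (by fun_prop) _ _
  have hA : IntegrableOn (fun ξ : V ↦ 1 + (2 + r ^ 2) * ‖ξ‖ ^ 2) (Metric.ball (0 : V) r) :=
    hc.add h1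
  have hB : IntegrableOn (fun ξ : V ↦ 1 + (2 + r ^ 2) * ‖ξ‖ ^ 2 + 4 * inner ℝ u ξ ^ 2)
    (Metric.ball (0 : V) r) := hA.add h2
  rw [setIntegral_ball_translate]
  calc ∫ ξ in Metric.ball (0 : V) r, ‖u + ξ‖ ^ 4
      ≤ ∫ ξ in Metric.ball (0 : V) r, (1 + (2 + r ^ 2) * ‖ξ‖ ^ 2 + 4 * inner ℝ u ξ ^ 2 +
          4 * inner ℝ u ξ * (1 + ‖ξ‖ ^ 2)) := by
        refine setIntegral_mono_on (integrableOn_ball_of_continuous (by fun_prop) _ _)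
          (hB.add h3) measurableSet_ball fun ξ hξ ↦ ?_
        rw [mem_ball_zero_iff] at hξ
        have h4 : ‖ξ‖ ^ 2 ≤ r ^ 2 := by gcongr
        have h5 : ‖u + ξ‖ ^ 4 = (1 + 2 * inner ℝ u ξ + ‖ξ‖ ^ 2) ^ 2 := by
          rw [show ‖u + ξ‖ ^ 4 = (‖u + ξ‖ ^ 2) ^ 2 by ring, norm_add_sq_real, hu]; ring
        rw [h5]
        -- The only loss is ‖ξ‖⁴ ≤ r²‖ξ‖²; every other term integrates exactly.
        nlinarith [sq_nonneg ‖ξ‖]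
    _ = volume.real (Metric.ball u r) * (1 + (2 + r ^ 2) * ballSecondMoment V r +
          4 * (ballSecondMoment V r / Module.finrank ℝ V)) := by
        rw [integral_add hB h3, integral_add hA h2, integral_add hc h1, integral_const_mul,
          integral_const_mul, setIntegral_ball_of_odd
            (f := fun ξ ↦ 4 * inner ℝ u ξ * (1 + ‖ξ‖ ^ 2)) (by simp),
          setIntegral_ball_norm_sq hr, setIntegral_ball_inner_sq hr, setIntegral_const,
          smul_eq_mul, measureReal_def, measureReal_def, Measure.addHaar_ball_center _ u, hu]
        ring
    _ ≤ _ := by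
        gcongr
        rw [ballSecondMoment]
        have hd : (0 : ℝ) < Module.finrank ℝ V := by positivity
        have : 1 + (2 + r ^ 2) * (r ^ 2 * (Module.finrank ℝ V : ℝ) / (Module.finrank ℝ V + 2)) +
            4 * (r ^ 2 * (Module.finrank ℝ V : ℝ) / (Module.finrank ℝ V + 2) /
              Module.finrank ℝ V) =
            (1 + r ^ 2) ^ 2 - 2 * r ^ 4 / (Module.finrank ℝ V + 2) := by
          field_simp; ring
        rw [this]
        have : 0 ≤ 2 * r ^ 4 / ((Module.finrank ℝ V : ℝ) + 2) := by positivity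
        linarith

end Smoothing

/-! ### Reduction of the optimisation over matrices to unit vectors -/

section LinearAlgebra

variable {D : ℕ}

lemma toEuclideanCLM_projMatrix (L : Submodule ℝ (EuclideanSpace ℝ (Fin D))) :
    Matrix.toEuclideanCLM (n := Fin D) (𝕜 := ℝ) (projMatrix L) = L.starProjection := by
  simp [projMatrix]

lemma inner_toEuclideanCLM_left {Q : Matrix (Fin D) (Fin D) ℝ} (hQ : Q = Q.transpose)
    (x y : EuclideanSpace ℝ (Fin D)) :
    inner ℝ (Matrix.toEuclideanCLM (n := Fin D) (𝕜 := ℝ) Q x) y =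
      inner ℝ x (Matrix.toEuclideanCLM (n := Fin D) (𝕜 := ℝ) Q y) := by
  have h : Q.IsHermitian := by
    rw [Matrix.IsHermitian, Matrix.conjTranspose_eq_transpose_of_trivial]; exact hQ.symm
  exact Matrix.isSymmetric_toEuclideanLin_iff.2 h x y

/-- In an eigenbasis, Cauchy–Schwarz gives ‖Qy‖·‖y‖ ≥ ∑ |c_j|⟨e_j, y⟩². Since the symmetric Q kills
L^⊥, every eigenvector with nonzero eigenvalue lies in L, where the hypothesis applies. The weights
satisfy ∑ |c_j| ≥ tr Q = 1. -/
lemma le_norm_toEuclideanCLM {L : Submodule ℝ (EuclideanSpace ℝ (Fin D))} {N : ℕ}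
    {x : Fin N → EuclideanSpace ℝ (Fin D)} {m : ℝ} (hm0 : 0 ≤ m) (s : Finset (Fin N))
    (hm : ∀ u ∈ L, ‖u‖ = 1 → m ≤ ∑ i ∈ s, inner ℝ u (x i) ^ 2 / ‖x i‖)
    {Q : Matrix (Fin D) (Fin D) ℝ} (hQ : Q ∈ traceOneSymm D) (hQL : Q * projMatrix Lᗮ = 0) :
    m ≤ ∑ i ∈ s, ‖Matrix.toEuclideanCLM (n := Fin D) (𝕜 := ℝ) Q (x i)‖ := by
  obtain ⟨hsymm, htr⟩ := hQ
  have hH : Q.IsHermitian := by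
    rw [Matrix.IsHermitian, Matrix.conjTranspose_eq_transpose_of_trivial]; exact hsymm.symm
  let T := Matrix.toEuclideanCLM (n := Fin D) (𝕜 := ℝ) Q
  let e := hH.eigenvectorBasis
  let c := hH.eigenvalues
  have hTe : ∀ j, T (e j) = c j • e j := by
    intro j
    have h := hH.mulVec_eigenvectorBasis j
    apply (WithLp.ofLp_injective 2)
    rw [Matrix.ofLp_toEuclideanCLM, h]
    rfl
  have hT0 : ∀ y ∈ Lᗮ, T y = 0 := by
    intro y hy
    have h := congrArg (fun M ↦ Matrix.toEuclideanCLM (n := Fin D) (𝕜 := ℝ) M y) hQL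
    simp only [map_mul, map_zero, toEuclideanCLM_projMatrix] at h
    rw [mul_apply_eq_comp, Submodule.starProjection_eq_self_iff.2 hy] at h
    exact h
  have heL : ∀ j, c j ≠ 0 → e j ∈ L := by
    intro j hj
    rw [← Submodule.orthogonal_orthogonal L, Submodule.mem_orthogonal]
    intro y hy
    have h := inner_toEuclideanCLM_left hsymm y (e j)
    change inner ℝ (T y) (e j) = inner ℝ y (T (e j)) at h
    rw [hT0 y hy, hTe, inner_zero_left, real_inner_smul_right] at h
    exact (mul_eq_zero.1 h.symm).resolve_left hj
  have hc : 1 ≤ ∑ j, |c j| := by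
    have h := hH.trace_eq_sum_eigenvalues
    rw [htr] at h
    calc (1 : ℝ) = ∑ j, c j := by simpa using h
      _ ≤ _ := Finset.sum_le_sum fun j _ ↦ le_abs_self _
  have hx : ∀ y, ∑ j, |c j| * (inner ℝ (e j) y ^ 2 / ‖y‖) ≤ ‖T y‖ := by
    intro y
    rcases eq_or_ne ‖y‖ 0 with h0 | h0
    · simp [h0]
    have h1 : ∀ j, |inner ℝ (e j) (T y)| = |c j| * |inner ℝ (e j) y| := by
      intro j
      have h := inner_toEuclideanCLM_left hsymm (e j) y
      change inner ℝ (T (e j)) y = inner ℝ (e j) (T y) at h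
      rw [← h, hTe, real_inner_smul_left, abs_mul]
    have h2 := Real.sum_mul_le_sqrt_mul_sqrt Finset.univ (fun j ↦ |inner ℝ (e j) (T y)|)
      (fun j ↦ |inner ℝ (e j) y|)
    simp only [sq_abs, e.sum_sq_inner_right, Real.sqrt_sq (norm_nonneg _)] at h2
    have h3 : ∑ j, |c j| * (inner ℝ (e j) y ^ 2 / ‖y‖) =
        (∑ j, |inner ℝ (e j) (T y)| * |inner ℝ (e j) y|) / ‖y‖ := by
      rw [Finset.sum_div]
      refine Finset.sum_congr rfl fun j _ ↦ ?_
      rw [h1, mul_assoc, ← sq, sq_abs, mul_div_assoc]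
    rw [h3, div_le_iff₀ (by positivity)]
    exact h2
  calc m ≤ (∑ j, |c j|) * m := le_mul_of_one_le_left hm0 hc
    _ = ∑ j, |c j| * m := Finset.sum_mul _ _ _
    _ ≤ ∑ j, |c j| * ∑ i ∈ s, inner ℝ (e j) (x i) ^ 2 / ‖x i‖ := by
        refine Finset.sum_le_sum fun j _ ↦ ?_
        rcases eq_or_ne (c j) 0 with h0 | h0
        · simp [h0]
        · exact mul_le_mul_of_nonneg_left (hm _ (heL j h0) (e.orthonormal.1 j)) (abs_nonneg _)
    _ = ∑ i ∈ s, ∑ j, |c j| * (inner ℝ (e j) (x i) ^ 2 / ‖x i‖) := by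
        simp_rw [Finset.mul_sum]
        exact Finset.sum_comm
    _ ≤ _ := Finset.sum_le_sum fun i _ ↦ hx _

/-- The witness is the rank-one projection uuᵀ onto a unit vector of L. Nonemptiness matters because
`sInf ∅ = 0` in ℝ. -/
lemma exists_mem_traceOneSymm {L : Submodule ℝ (EuclideanSpace ℝ (Fin D))} (hL : L ≠ ⊥) :
    ∃ Q, Q ∈ traceOneSymm D ∧ Q * projMatrix Lᗮ = 0 := by
  obtain ⟨v, hv, hv0⟩ := L.exists_mem_ne_zero_of_ne_bot hL
  let u := ‖v‖⁻¹ • v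
  have hu : ‖u‖ = 1 := by simp [u, norm_smul, hv0]
  have huL : u ∈ L := L.smul_mem _ hv
  refine ⟨Matrix.vecMulVec u.ofLp u.ofLp, ⟨(Matrix.transpose_vecMulVec _ _).symm, ?_⟩, ?_⟩
  · rw [Matrix.trace_vecMulVec]
    have := real_inner_self_eq_norm_sq u
    rw [hu, PiLp.inner_apply] at this
    simpa [dotProduct, sq] using this
  · apply (Matrix.toEuclideanCLM (n := Fin D) (𝕜 := ℝ)).injective
    change Matrix.toEuclideanCLM (n := Fin D) (𝕜 := ℝ) _ =
      Matrix.toEuclideanCLM (n := Fin D) (𝕜 := ℝ) _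
    rw [map_mul, map_zero, toEuclideanCLM_projMatrix]
    ext1 y
    apply (WithLp.ofLp_injective 2)
    rw [mul_apply_eq_comp, Matrix.ofLp_toEuclideanCLM, Matrix.vecMulVec_mulVec]
    have h : u.ofLp ⬝ᵥ (Lᗮ.starProjection y).ofLp = inner ℝ u (Lᗮ.starProjection y) := by
      simp [PiLp.inner_apply, dotProduct, mul_comm]
    rw [h, Submodule.inner_right_of_mem_orthogonal huL (Submodule.starProjection_apply_mem _ _)]
    simp

open Classical in
lemma le_inlierMin {L : Submodule ℝ (EuclideanSpace ℝ (Fin D))} (hL : L ≠ ⊥) {N : ℕ}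
    {x : Fin N → EuclideanSpace ℝ (Fin D)} {m : ℝ} (hm0 : 0 ≤ m)
    (hm : ∀ u ∈ L, ‖u‖ = 1 →
      m ≤ ∑ i, if x i ∈ L then inner ℝ u (x i) ^ 2 / ‖x i‖ else 0) :
    m ≤ inlierMin L x := by
  have hne : {Q | Q ∈ traceOneSymm D ∧ Q * projMatrix Lᗮ = 0}.Nonempty :=
    exists_mem_traceOneSymm hL
  refine le_csInf (hne.image _) ?_
  rintro _ ⟨Q, ⟨hQ, hQL⟩, rfl⟩
  refine le_norm_toEuclideanCLM hm0 _ (fun u huL hu ↦ ?_) hQ hQL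
  rw [Finset.sum_filter]
  exact hm u huL hu

lemma outlierSum_nonneg (L : Submodule ℝ (EuclideanSpace ℝ (Fin D))) {N : ℕ}
    (x : Fin N → EuclideanSpace ℝ (Fin D)) (v : EuclideanSpace ℝ (Fin D)) :
    0 ≤ outlierSum L x v := Finset.sum_nonneg fun _ _ ↦ abs_nonneg _

lemma outlierMinPerp_le {L : Submodule ℝ (EuclideanSpace ℝ (Fin D))} {N : ℕ}
    (x : Fin N → EuclideanSpace ℝ (Fin D)) {v : EuclideanSpace ℝ (Fin D)} (hv : v ∈ Lᗮ)
    (hv1 : ‖v‖ = 1) : outlierMinPerp L x ≤ outlierSum L x v := by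
  refine csInf_le ⟨0, ?_⟩ ⟨v, ⟨hv, hv1⟩, rfl⟩
  rintro _ ⟨w, _, rfl⟩
  exact outlierSum_nonneg L x w

lemma outlierMax_le {L : Submodule ℝ (EuclideanSpace ℝ (Fin D))} {N : ℕ}
    {x : Fin N → EuclideanSpace ℝ (Fin D)} {m : ℝ} (hm0 : 0 ≤ m)
    (hm : ∀ u ∈ L, ‖u‖ = 1 → outlierSum L x u ≤ m) : outlierMax L x ≤ m := by
  refine Real.sSup_le ?_ hm0
  rintro _ ⟨u, ⟨huL, hu⟩, rfl⟩
  exact hm u huL hu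

lemma exists_mem_orthogonal_norm_eq_one {L : Submodule ℝ (EuclideanSpace ℝ (Fin D))}
    (hL : Module.finrank ℝ L < D) : ∃ v ∈ Lᗮ, ‖v‖ = 1 := by
  have h : Lᗮ ≠ ⊥ := by
    intro h
    rw [Submodule.orthogonal_eq_bot_iff] at h
    rw [h] at hL
    simp at hL
  obtain ⟨v, hv, hv0⟩ := Lᗮ.exists_mem_ne_zero_of_ne_bot h
  exact ⟨‖v‖⁻¹ • v, Lᗮ.smul_mem _ hv, by simp [norm_smul, hv0]⟩

end LinearAlgebra

/-! ### The two components as images of standard Gaussians -/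

section Laws

variable {D : ℕ}

lemma outlierMeasure_eq_map (D : ℕ) (σ : ℝ) :
    outlierMeasure D σ =
      (stdGaussian (EuclideanSpace ℝ (Fin D))).map (fun x ↦ (σ / √D) • x) := by
  have hS : ((σ ^ 2 / (D : ℝ)) • (1 : Matrix (Fin D) (Fin D) ℝ)).PosSemidef :=
    Matrix.PosSemidef.one.smul (by positivity)
  have : IsProbabilityMeasure (outlierMeasure D σ) := by
    unfold outlierMeasure; infer_instance
  have : IsProbabilityMeasure
      ((stdGaussian (EuclideanSpace ℝ (Fin D))).map (fun x ↦ (σ / √D) • x)) :=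
    Measure.isProbabilityMeasure_map (by fun_prop)
  apply Measure.ext_of_charFun
  ext t
  have hn : ‖(σ / √(D : ℝ)) • t‖ ^ 2 = σ ^ 2 / (D : ℝ) * ‖t‖ ^ 2 := by
    rw [norm_smul, mul_pow, Real.norm_eq_abs, sq_abs, div_pow, Real.sq_sqrt (Nat.cast_nonneg D)]
  rw [outlierMeasure, charFun_multivariateGaussian hS, charFun_map_smul, charFun_stdGaussian,
    ← Matrix.inner_toEuclideanCLM, map_smul, map_one, inner_zero_right, ← Complex.ofReal_pow, hn]
  simp only [smul_apply, one_apply_eq_self, real_inner_smul_right, real_inner_self_eq_norm_sq]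
  congr 1
  push_cast
  ring

/-- Characteristic functions agree because P Pᵀ = P and ⟨t, Pt⟩ = ‖Pt‖². Working on L itself makes
the law isotropic in dimension d, so the moment formulas above apply. -/
lemma inlierMeasure_eq_map (L : Submodule ℝ (EuclideanSpace ℝ (Fin D))) (σ : ℝ) :
    inlierMeasure L σ = (stdGaussian L).map
      (fun x : L ↦ (σ / √(Module.finrank ℝ L)) • (x : EuclideanSpace ℝ (Fin D))) := by
  have hP : projMatrix L * (projMatrix L).transpose = projMatrix L := by
    apply (Matrix.toEuclideanCLM (n := Fin D) (𝕜 := ℝ)).injective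
    change Matrix.toEuclideanCLM (n := Fin D) (𝕜 := ℝ) _ =
      Matrix.toEuclideanCLM (n := Fin D) (𝕜 := ℝ) _
    rw [map_mul, ← Matrix.conjTranspose_eq_transpose_of_trivial, ← Matrix.star_eq_conjTranspose,
      map_star, toEuclideanCLM_projMatrix, (isSelfAdjoint_starProjection L).star_eq,
      L.isIdempotentElem_starProjection.eq]
  have hS : ((σ ^ 2 / (Module.finrank ℝ L : ℝ)) •
      (projMatrix L * (projMatrix L).transpose)).PosSemidef := by
    rw [← Matrix.conjTranspose_eq_transpose_of_trivial]
    exact (Matrix.posSemidef_self_mul_conjTranspose _).smul (by positivity)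
  have : IsProbabilityMeasure (inlierMeasure L σ) := by
    unfold inlierMeasure; infer_instance
  have : IsProbabilityMeasure ((stdGaussian L).map
      (fun x : L ↦ (σ / √(Module.finrank ℝ L)) • (x : EuclideanSpace ℝ (Fin D)))) :=
    Measure.isProbabilityMeasure_map (by fun_prop)
  apply Measure.ext_of_charFun
  ext t
  have h1 : charFun ((stdGaussian L).map
      (fun x : L ↦ (σ / √(Module.finrank ℝ L)) • (x : EuclideanSpace ℝ (Fin D)))) t =
      charFun (stdGaussian L) ((σ / √(Module.finrank ℝ L)) • L.orthogonalProjectionOnto t) := by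
    rw [charFun_apply, charFun_apply, integral_map (by fun_prop)
      (Measurable.aestronglyMeasurable (by fun_prop))]
    congr 1; ext x
    rw [real_inner_smul_left, Submodule.coe_inner, Submodule.coe_smul, real_inner_smul_right,
      ← Submodule.coe_inner, Submodule.inner_orthogonalProjectionOnto_eq_of_mem_left]
  have h2 : inner ℝ t (L.starProjection t) = ‖L.orthogonalProjectionOnto t‖ ^ 2 := by
    rw [real_inner_comm]
    exact L.re_inner_starProjection_eq_normSq t
  have hn : ‖(σ / √(Module.finrank ℝ L : ℝ)) • L.orthogonalProjectionOnto t‖ ^ 2 =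
      σ ^ 2 / (Module.finrank ℝ L : ℝ) * ‖L.orthogonalProjectionOnto t‖ ^ 2 := by
    rw [norm_smul, mul_pow, Real.norm_eq_abs, sq_abs, div_pow, Real.sq_sqrt (Nat.cast_nonneg _)]
  rw [h1, inlierMeasure, charFun_multivariateGaussian hS, charFun_stdGaussian,
    ← Matrix.inner_toEuclideanCLM, hP, map_smul, toEuclideanCLM_projMatrix, inner_zero_right,
    ← Complex.ofReal_pow, hn]
  simp only [smul_apply, real_inner_smul_right, h2]
  congr 1
  push_cast
  ring

end Laws

/-! ### Exponential moments of i.i.d. sums -/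

section Product

/-- Independence and 1 + k ≤ eᵏ. The number k may be negative, as it is for lower tails with a
positive rate. -/
lemma lintegral_exp_sum_sub_le_one {E : Type*} [MeasurableSpace E] {μ : Measure E}
    [IsProbabilityMeasure μ] {G : E → ℝ} (hG : Measurable G) {k : ℝ}
    (h : ∫⁻ x, ENNReal.ofReal (Real.exp (G x)) ∂μ ≤ ENNReal.ofReal (1 + k)) (N : ℕ) :
    ∫⁻ x : Fin N → E, ENNReal.ofReal (Real.exp (∑ i, G (x i) - N * k))
      ∂(Measure.pi fun _ ↦ μ) ≤ 1 := by
  have h1 : ∀ x : Fin N → E, ENNReal.ofReal (Real.exp (∑ i, G (x i) - N * k)) =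
      ENNReal.ofReal (Real.exp (-(N * k))) * ∏ i, ENNReal.ofReal (Real.exp (G (x i))) := by
    intro x
    rw [← ENNReal.ofReal_prod_of_nonneg fun i _ ↦ (Real.exp_pos _).le,
      ← ENNReal.ofReal_mul (Real.exp_pos _).le, ← Real.exp_sum, ← Real.exp_add]
    ring_nf
  have hm : Measurable fun x ↦ ENNReal.ofReal (Real.exp (G x)) := by fun_prop
  have hind : iIndepFun (fun (i : Fin N) (x : Fin N → E) ↦ ENNReal.ofReal (Real.exp (G (x i))))
      (Measure.pi fun _ ↦ μ) :=
    iIndepFun_pi (X := fun _ x ↦ ENNReal.ofReal (Real.exp (G x))) fun _ ↦ hm.aemeasurable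
  simp_rw [h1]
  rw [lintegral_const_mul _ (by fun_prop),
    lintegral_prod_eq_prod_lintegral_of_indepFun _ _ hind fun i ↦ hm.comp (measurable_pi_apply i)]
  have h2 : ∀ i : Fin N, ∫⁻ x : Fin N → E, ENNReal.ofReal (Real.exp (G (x i)))
      ∂(Measure.pi fun _ ↦ μ) ≤ ENNReal.ofReal (Real.exp k) := by
    intro i
    rw [(measurePreserving_eval (fun _ : Fin N ↦ μ) i).lintegral_comp hm]
    refine h.trans (ENNReal.ofReal_le_ofReal ?_)
    linarith [Real.add_one_le_exp k]
  calc ENNReal.ofReal (Real.exp (-(N * k))) * ∏ i : Fin N, ∫⁻ x : Fin N → E,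
        ENNReal.ofReal (Real.exp (G (x i))) ∂(Measure.pi fun _ ↦ μ)
      ≤ ENNReal.ofReal (Real.exp (-(N * k))) * ∏ i : Fin N, ENNReal.ofReal (Real.exp k) := by
        gcongr with i
        exact h2 i
    _ = 1 := by
        rw [Finset.prod_const, ← ENNReal.ofReal_pow (Real.exp_pos _).le,
          ← ENNReal.ofReal_mul (Real.exp_pos _).le, ← Real.exp_nat_mul, ← Real.exp_add]
        simp

lemma measure_le_exp_neg_of_lintegral_exp_le_one {Ω : Type*} [MeasurableSpace Ω]
    {P : Measure Ω} {Y : Ω → ℝ} (hY : Measurable Y)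
    (h : ∫⁻ ω, ENNReal.ofReal (Real.exp (Y ω)) ∂P ≤ 1) (t : ℝ) :
    P {ω | t ≤ Y ω} ≤ ENNReal.ofReal (Real.exp (-t)) := by
  have hm := (mul_meas_ge_le_lintegral (μ := P) (f := fun ω ↦ ENNReal.ofReal (Real.exp (Y ω)))
    (by fun_prop) (ENNReal.ofReal (Real.exp t))).trans h
  have hs : {ω | ENNReal.ofReal (Real.exp t) ≤ ENNReal.ofReal (Real.exp (Y ω))} =
      {ω | t ≤ Y ω} := by
    ext ω
    simp [ENNReal.ofReal_le_ofReal_iff (Real.exp_pos _).le]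
  rw [hs] at hm
  rw [Real.exp_neg, ENNReal.ofReal_inv_of_pos (Real.exp_pos t)]
  rw [mul_comm] at hm
  rw [← one_div]
  exact (ENNReal.le_div_iff_mul_le (Or.inl (by simpa using Real.exp_pos t))
    (Or.inl ENNReal.ofReal_ne_top)).2 hm

end Product

/-! ### Mixture moments and almost sure membership in L -/

section Laws

variable {D : ℕ}

lemma measurableSet_submodule (L : Submodule ℝ (EuclideanSpace ℝ (Fin D))) :
    MeasurableSet (L : Set (EuclideanSpace ℝ (Fin D))) :=
  L.closed_of_finiteDimensional.measurableSet

instance (σ : ℝ) : IsProbabilityMeasure (outlierMeasure D σ) := by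
  unfold outlierMeasure; infer_instance

instance (L : Submodule ℝ (EuclideanSpace ℝ (Fin D))) (σ : ℝ) :
    IsProbabilityMeasure (inlierMeasure L σ) := by
  unfold inlierMeasure; infer_instance

lemma isProbabilityMeasure_mixtureMeasure (L : Submodule ℝ (EuclideanSpace ℝ (Fin D)))
    {α₀ α₁ : ℝ} (hα₀ : 0 ≤ α₀) (hα₁ : 0 ≤ α₁) (hα : α₀ + α₁ = 1) (σ₀ σ₁ : ℝ) :
    IsProbabilityMeasure (mixtureMeasure L α₀ α₁ σ₀ σ₁) := by
  refine ⟨?_⟩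
  simp [mixtureMeasure, ← ENNReal.ofReal_add hα₀ hα₁, hα]

lemma lintegral_exp_mixtureMeasure_le {L : Submodule ℝ (EuclideanSpace ℝ (Fin D))}
    {α₀ α₁ : ℝ} (hα₀ : 0 ≤ α₀) (hα₁ : 0 ≤ α₁) {σ₀ σ₁ : ℝ}
    {F : EuclideanSpace ℝ (Fin D) → ENNReal} {a b : ℝ} (ha : 0 ≤ a) (hb : 0 ≤ b)
    (h₀ : ∫⁻ x, F x ∂(outlierMeasure D σ₀) ≤ ENNReal.ofReal a)
    (h₁ : ∫⁻ x, F x ∂(inlierMeasure L σ₁) ≤ ENNReal.ofReal b) :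
    ∫⁻ x, F x ∂(mixtureMeasure L α₀ α₁ σ₀ σ₁) ≤ ENNReal.ofReal (α₀ * a + α₁ * b) := by
  rw [mixtureMeasure, lintegral_add_measure, lintegral_smul_measure, lintegral_smul_measure,
    ENNReal.ofReal_add (by positivity) (by positivity), ENNReal.ofReal_mul hα₀,
    ENNReal.ofReal_mul hα₁]
  simp only [smul_eq_mul]
  gcongr

lemma ae_mem_inlierMeasure (L : Submodule ℝ (EuclideanSpace ℝ (Fin D))) (σ : ℝ) :
    ∀ᵐ x ∂(inlierMeasure L σ), x ∈ L := by
  rw [inlierMeasure_eq_map, ae_map_iff (p := fun x ↦ x ∈ L) (by fun_prop) (measurableSet_submodule L)]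
  exact ae_of_all _ fun x ↦ L.smul_mem _ x.2

/-- A unit normal v to L has a nondegenerate Gaussian inner product with the outlier, which is
almost surely nonzero. -/
lemma ae_notMem_outlierMeasure {L : Submodule ℝ (EuclideanSpace ℝ (Fin D))}
    (hL : Module.finrank ℝ L < D) {σ : ℝ} (hσ : 0 < σ) :
    ∀ᵐ x ∂(outlierMeasure D σ), x ∉ L := by
  obtain ⟨v, hv, hv1⟩ := exists_mem_orthogonal_norm_eq_one hL
  have hD : 0 < D := by omega
  have hτ : σ / √(D : ℝ) ≠ 0 := by positivity
  have h0 : ∀ᵐ t ∂(gaussianReal 0 1), t ≠ 0 := by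
    have := nullSingletonClass_gaussianReal (μ := 0) (v := 1) one_ne_zero
    simp [ae_iff]
  rw [← map_inner_stdGaussian hv1] at h0
  have h1 := ae_of_ae_map (by fun_prop) h0
  rw [outlierMeasure_eq_map, ae_map_iff (p := fun x ↦ x ∉ L) (by fun_prop)
    (measurableSet_submodule L).compl]
  filter_upwards [h1] with x hx hxL
  have hxL' : x ∈ L := by
    have := L.smul_mem (σ / √(D : ℝ))⁻¹ hxL
    rwa [smul_smul, inv_mul_cancel₀ hτ, one_smul] at this
  exact hx (Submodule.inner_left_of_mem_orthogonal hxL' hv)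

lemma lintegral_exp_mul_abs_inner_outlierMeasure_le (hD : 0 < D) {σ a : ℝ} (hσ : 0 < σ)
    (ha : 0 ≤ a) (v : EuclideanSpace ℝ (Fin D)) (hs : (a * (σ / √D) * ‖v‖) ^ 2 < 3) :
    ∫⁻ x, ENNReal.ofReal (Real.exp (a * |inner ℝ v x|)) ∂(outlierMeasure D σ) ≤
      ENNReal.ofReal (Real.exp ((a * (σ / √D) * ‖v‖) ^ 2 / 2) + (a * (σ / √D) * ‖v‖) *
        (√(2 / Real.pi) / (1 - (a * (σ / √D) * ‖v‖) ^ 2 / 3))) := by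
  rcases eq_or_ne v 0 with rfl | hv
  · simp
  let e := ‖v‖⁻¹ • v
  have he : ‖e‖ = 1 := by simp [e, norm_smul, hv]
  have hve : v = ‖v‖ • e := by simp [e, smul_smul, hv]
  set s := a * (σ / √D) * ‖v‖ with hsdef
  have hs0 : 0 ≤ s := by positivity
  have hi := integrable_comp_inner_stdGaussian he (integrable_exp_mul_abs s)
  rw [outlierMeasure_eq_map, lintegral_map (by fun_prop) (by fun_prop)]
  have h1 : ∀ x : EuclideanSpace ℝ (Fin D),
      a * |inner ℝ v ((σ / √D) • x)| = s * |inner ℝ e x| := by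
    intro x
    conv_lhs => rw [hve]
    rw [real_inner_smul_left, real_inner_smul_right, abs_mul, abs_mul, abs_norm,
      abs_of_nonneg (by positivity : 0 ≤ σ / √(D : ℝ)), hsdef]
    ring
  simp_rw [h1]
  rw [← ofReal_integral_eq_lintegral_ofReal hi (ae_of_all _ fun x ↦ (Real.exp_pos _).le)]
  apply ENNReal.ofReal_le_ofReal
  rw [integral_comp_inner_stdGaussian he (f := fun t ↦ Real.exp (s * |t|)) (by fun_prop)]
  exact integral_exp_mul_abs_le hs0 hs

end Laws

/-! ### Numerical bounds for the outlier exponent -/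

section Numeric

lemma sqrt_two_div_pi_lt : √(2 / Real.pi) < 0.79789 := by
  rw [Real.sqrt_lt' (by norm_num), div_lt_iff₀ Real.pi_pos]
  linarith [Real.pi_gt_d6]

lemma lt_sqrt_two_div_pi : 0.7978 < √(2 / Real.pi) := by
  rw [Real.lt_sqrt (by norm_num), lt_div_iff₀ Real.pi_pos]
  linarith [Real.pi_lt_d6]

/-- A majorant in t² is wanted because the ball average of ‖θ‖² is known exactly. The range t ≤ 6/5
is 1 + r with smoothing radius r = 1/5, and 4/25 is the chosen exponential tilt. -/
lemma exp_sq_add_le {t : ℝ} (ht0 : 0 ≤ t) (ht : t ≤ 6 / 5) :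
    Real.exp ((4 / 25 * t) ^ 2 / 2) +
      (4 / 25 * t) * (√(2 / Real.pi) / (1 - (4 / 25 * t) ^ 2 / 3)) ≤
      1 + (0.0652 + 0.077 * t ^ 2) := by
  have ht2 : t ^ 2 ≤ 36 / 25 := by nlinarith
  have h1 : Real.exp ((4 / 25 * t) ^ 2 / 2) ≤ 1 + 0.013037 * t ^ 2 := by
    have h := Real.abs_exp_sub_one_sub_id_le (x := (4 / 25 * t) ^ 2 / 2)
      (by rw [abs_of_nonneg (by positivity)]; nlinarith)
    have h2 := (abs_le.1 h).2
    nlinarith [sq_nonneg (t ^ 2)]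
  have h2 : √(2 / Real.pi) / (1 - (4 / 25 * t) ^ 2 / 3) ≤ 0.79789 * (1 + 0.00865 * t ^ 2) := by
    rw [div_le_iff₀ (by nlinarith)]
    have := sqrt_two_div_pi_lt
    nlinarith [sq_nonneg (t ^ 2)]
  have h3 : (4 / 25 * t) * (√(2 / Real.pi) / (1 - (4 / 25 * t) ^ 2 / 3)) ≤
      (4 / 25 * t) * (0.79789 * (1 + 0.00865 * t ^ 2)) := by gcongr
  nlinarith [sq_nonneg (t - 1.02), mul_nonneg (sq_nonneg t) (sub_nonneg.2 ht)]

end Numeric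

/-! ### Upper tails of the outlier sums -/

section Outliers

variable {D : ℕ}

open Classical in
/-- The scaled contribution of a data point `x` to `outlierSum L _ v`. -/
def outlierTerm (L : Submodule ℝ (EuclideanSpace ℝ (Fin D))) (a : ℝ)
    (v x : EuclideanSpace ℝ (Fin D)) : ℝ :=
  if x ∈ L then 0 else a * |inner ℝ v x|

lemma sum_outlierTerm (L : Submodule ℝ (EuclideanSpace ℝ (Fin D))) (a : ℝ) {N : ℕ}
    (v : EuclideanSpace ℝ (Fin D)) (x : Fin N → EuclideanSpace ℝ (Fin D)) :
    ∑ i, outlierTerm L a v (x i) = a * outlierSum L x v := by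
  classical
  rw [outlierSum, Finset.sum_filter, Finset.mul_sum]
  refine Finset.sum_congr rfl fun i _ ↦ ?_
  by_cases h : x i ∈ L <;> simp [outlierTerm, h]

lemma measurable_outlierTerm (L : Submodule ℝ (EuclideanSpace ℝ (Fin D))) (a : ℝ) :
    Measurable fun p : EuclideanSpace ℝ (Fin D) × EuclideanSpace ℝ (Fin D) ↦
      outlierTerm L a p.1 p.2 := by
  classical
  exact Measurable.ite (measurable_snd (measurableSet_submodule L)) measurable_const
    (by fun_prop)

lemma continuous_outlierTerm (L : Submodule ℝ (EuclideanSpace ℝ (Fin D))) (a : ℝ)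
    (x : EuclideanSpace ℝ (Fin D)) : Continuous fun v ↦ outlierTerm L a v x := by
  unfold outlierTerm
  split_ifs <;> fun_prop

/-- Inliers lie in L almost surely and contribute exactly 1, so only the weight α₀ multiplies the
excess. Dividing by σ₀/√D normalises the tilt to 4/25. -/
lemma lintegral_exp_outlierTerm_le (hD : 0 < D) (L : Submodule ℝ (EuclideanSpace ℝ (Fin D)))
    {α₀ α₁ σ₀ σ₁ : ℝ} (hα₀ : 0 < α₀) (hα₁ : 0 < α₁) (hα : α₀ + α₁ = 1) (hσ₀ : 0 < σ₀)
    {v : EuclideanSpace ℝ (Fin D)} (hv : ‖v‖ ≤ 6 / 5) :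
    ∫⁻ x, ENNReal.ofReal (Real.exp (outlierTerm L (4 / 25 / (σ₀ / √D)) v x))
      ∂(mixtureMeasure L α₀ α₁ σ₀ σ₁) ≤
      ENNReal.ofReal (1 + α₀ * (0.0652 + 0.077 * ‖v‖ ^ 2)) := by
  have hτ : 0 < σ₀ / √(D : ℝ) := by positivity
  have ha : 4 / 25 / (σ₀ / √D) * (σ₀ / √D) * ‖v‖ = 4 / 25 * ‖v‖ := by
    rw [div_mul_cancel₀ _ hτ.ne']
  have hv0 := norm_nonneg v
  have h₀ : ∫⁻ x, ENNReal.ofReal (Real.exp (outlierTerm L (4 / 25 / (σ₀ / √D)) v x))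
      ∂(outlierMeasure D σ₀) ≤ ENNReal.ofReal (1 + (0.0652 + 0.077 * ‖v‖ ^ 2)) := by
    have h := lintegral_exp_mul_abs_inner_outlierMeasure_le hD hσ₀
      (a := 4 / 25 / (σ₀ / √D)) (by positivity) v (by rw [ha]; nlinarith)
    rw [ha] at h
    refine (lintegral_mono fun x ↦ ?_).trans
      (h.trans (ENNReal.ofReal_le_ofReal (exp_sq_add_le hv0 hv)))
    apply ENNReal.ofReal_le_ofReal
    apply Real.exp_le_exp.2
    unfold outlierTerm
    split_ifs
    · positivity
    · exact le_rfl
  have h₁ : ∫⁻ x, ENNReal.ofReal (Real.exp (outlierTerm L (4 / 25 / (σ₀ / √D)) v x))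
      ∂(inlierMeasure L σ₁) ≤ ENNReal.ofReal 1 := by
    rw [lintegral_congr_ae (g := fun _ ↦ ENNReal.ofReal 1)]
    · simp
    · filter_upwards [ae_mem_inlierMeasure L σ₁] with x hx
      simp [outlierTerm, hx]
  refine (lintegral_exp_mixtureMeasure_le hα₀.le hα₁.le (by positivity) zero_le_one
    h₀ h₁).trans (ENNReal.ofReal_le_ofReal (le_of_eq ?_))
  linear_combination hα

lemma measure_outlierSum_ge_le (hD : 0 < D) (L : Submodule ℝ (EuclideanSpace ℝ (Fin D)))
    {α₀ α₁ σ₀ σ₁ : ℝ} (hα₀ : 0 < α₀) (hα₁ : 0 < α₁) (hα : α₀ + α₁ = 1) (hσ₀ : 0 < σ₀)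
    {v : EuclideanSpace ℝ (Fin D)} (hv : ‖v‖ = 1) (N : ℕ) :
    (Measure.pi fun _ : Fin N ↦ mixtureMeasure L α₀ α₁ σ₀ σ₁)
      {x | 1.012 * (σ₀ / √D * (α₀ * N)) ≤ outlierSum L x v} ≤
      ENNReal.ofReal (Real.exp (-(0.0197 * (α₀ * N)))) := by
  have := isProbabilityMeasure_mixtureMeasure L hα₀.le hα₁.le hα σ₀ σ₁
  have hτ : 0 < σ₀ / √(D : ℝ) := by positivity
  have hm : Measurable fun x ↦ outlierTerm L (4 / 25 / (σ₀ / √D)) v x :=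
    (measurable_outlierTerm L _).comp (measurable_const.prodMk measurable_id)
  have h := lintegral_exp_sum_sub_le_one hm (lintegral_exp_outlierTerm_le hD L
    (σ₁ := σ₁) hα₀ hα₁ hα hσ₀ (v := v) (by rw [hv]; norm_num)) N
  have h2 := measure_le_exp_neg_of_lintegral_exp_le_one (by fun_prop) h (0.0197 * (α₀ * N))
  refine (measure_mono fun x hx ↦ ?_).trans h2
  simp only [Set.mem_ofPred_eq] at hx ⊢
  rw [sum_outlierTerm, hv]
  have h3 : 4 / 25 / (σ₀ / √D) * (1.012 * (σ₀ / √D * (α₀ * N))) ≤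
      4 / 25 / (σ₀ / √D) * outlierSum L x v := by gcongr
  have h4 : 4 / 25 / (σ₀ / √D) * (1.012 * (σ₀ / √D * (α₀ * N))) =
      4 / 25 * 1.012 * (α₀ * N) := by field_simp
  rw [h4] at h3
  have : 0 ≤ α₀ * N := by positivity
  -- The available rate is (4/25)·1.012 - 0.0652 - 0.077 = 0.01972.
  nlinarith

lemma pow_mul_exp_neg_le {n : ℕ} {b c p t T : ℝ} (hb : 0 ≤ b) (hbc : b ≤ Real.exp c)
    (hn : c * n + T ≤ t) (hp : p ≤ T) : b ^ n * Real.exp (-t) ≤ Real.exp (-p) := by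
  calc b ^ n * Real.exp (-t) ≤ Real.exp c ^ n * Real.exp (-t) := by gcongr
    _ = Real.exp (n * c - t) := by rw [← Real.exp_nat_mul, ← Real.exp_add]; ring_nf
    _ ≤ _ := Real.exp_le_exp.2 (by linarith)

lemma six_le_exp : (6 : ℝ) ≤ Real.exp (9 / 5) := by
  have h : (6 : ℝ) ^ 5 ≤ Real.exp (9 / 5) ^ 5 := by
    rw [← Real.exp_nat_mul, show ((5 : ℕ) : ℝ) * (9 / 5) = ((9 : ℕ) : ℝ) * 1 by norm_num,
      Real.exp_nat_mul]
    calc (6 : ℝ) ^ 5 ≤ 2.718 ^ 9 := by norm_num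
      _ ≤ _ := by gcongr; linarith [Real.exp_one_gt_d9]
  exact le_of_pow_le_pow_left₀ (by norm_num) (Real.exp_pos _).le h

lemma four_le_exp : (4 : ℝ) ≤ Real.exp (7 / 5) := by
  have h : (4 : ℝ) ^ 5 ≤ Real.exp (7 / 5) ^ 5 := by
    rw [← Real.exp_nat_mul, show ((5 : ℕ) : ℝ) * (7 / 5) = ((7 : ℕ) : ℝ) * 1 by norm_num,
      Real.exp_nat_mul]
    calc (4 : ℝ) ^ 5 ≤ 2.718 ^ 7 := by norm_num
      _ ≤ _ := by gcongr; linarith [Real.exp_one_gt_d9]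
  exact le_of_pow_le_pow_left₀ (by norm_num) (Real.exp_pos _).le h

lemma ballSecondMoment_nonneg (V : Type*) [NormedAddCommGroup V] [InnerProductSpace ℝ V] (r : ℝ) :
    0 ≤ ballSecondMoment V r := by unfold ballSecondMoment; positivity

lemma ballSecondMoment_le (V : Type*) [NormedAddCommGroup V] [InnerProductSpace ℝ V] (r : ℝ) :
    ballSecondMoment V r ≤ r ^ 2 := by
  unfold ballSecondMoment
  rw [div_le_iff₀ (by positivity)]
  nlinarith [sq_nonneg r]

lemma outlierTerm_le_setIntegral_ball (L : Submodule ℝ (EuclideanSpace ℝ (Fin D))) {a : ℝ}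
    (ha : 0 ≤ a) (u : L) (x : EuclideanSpace ℝ (Fin D)) (r : ℝ) :
    outlierTerm L a u x * volume.real (Metric.ball u r) ≤
      ∫ θ in Metric.ball u r, outlierTerm L a (θ : L) x := by
  unfold outlierTerm
  split_ifs with h
  · simp
  · have h1 := abs_inner_le_setIntegral_ball u (L.orthogonalProjectionOnto x) r
    simp only [Submodule.inner_orthogonalProjectionOnto_eq_of_mem_left] at h1
    rw [integral_const_mul, mul_assoc]
    gcongr

lemma measure_exists_outlierSum_gt_le (hD : 0 < D) (L : Submodule ℝ (EuclideanSpace ℝ (Fin D)))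
    {α₀ α₁ σ₀ σ₁ : ℝ} (hα₀ : 0 < α₀) (hα₁ : 0 < α₁) (hα : α₀ + α₁ = 1) (hσ₀ : 0 < σ₀)
    {N : ℕ} (hN : 128 * (Module.finrank ℝ L : ℝ) ≤ α₀ * N) :
    (Measure.pi fun _ : Fin N ↦ mixtureMeasure L α₀ α₁ σ₀ σ₁)
      {x | ∃ u ∈ L, ‖u‖ = 1 ∧ 1.012 * (σ₀ / √D * (α₀ * N)) ≤ outlierSum L x u} ≤
      ENNReal.ofReal (Real.exp (-(α₀ * N / 400))) := by
  have := isProbabilityMeasure_mixtureMeasure L hα₀.le hα₁.le hα σ₀ σ₁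
  have hτ : 0 < σ₀ / √(D : ℝ) := by positivity
  set a := 4 / 25 / (σ₀ / √(D : ℝ)) with ha
  have hapos : 0 < a := by positivity
  let k : L → ℝ := fun θ ↦ α₀ * (0.0652 + 0.077 * ‖θ‖ ^ 2)
  let Φ : L → (Fin N → EuclideanSpace ℝ (Fin D)) → ℝ := fun θ x ↦
    ∑ i, outlierTerm L a (θ : EuclideanSpace ℝ (Fin D)) (x i) - N * k θ
  have hmeas : Measurable (Function.uncurry Φ) := by
    refine Measurable.sub (Finset.measurable_sum _ fun i _ ↦ ?_) (by fun_prop)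
    exact (measurable_outlierTerm L a).comp (f := fun p : L × (Fin N → EuclideanSpace ℝ (Fin D)) ↦
      ((p.1 : EuclideanSpace ℝ (Fin D)), p.2 i)) (by fun_prop)
  have hterm : ∀ x, Continuous fun θ : L ↦ outlierTerm L a (θ : EuclideanSpace ℝ (Fin D)) x :=
    fun x ↦ (continuous_outlierTerm L a x).comp continuous_subtype_val
  have hk : Continuous k := by fun_prop
  have hcont : ∀ x, Continuous fun θ ↦ Φ θ x := fun x ↦
    (continuous_finsetSum _ fun i _ ↦ hterm (x i)).sub (continuous_const.mul hk)
  have hexp : ∀ θ, ‖θ‖ < 1 + 1 / 5 → ∫⁻ x, ENNReal.ofReal (Real.exp (Φ θ x))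
      ∂(Measure.pi fun _ : Fin N ↦ mixtureMeasure L α₀ α₁ σ₀ σ₁) ≤ 1 := by
    intro θ hθ
    refine lintegral_exp_sum_sub_le_one ((measurable_outlierTerm L a).comp
      (measurable_const.prodMk measurable_id)) ?_ N
    exact lintegral_exp_outlierTerm_le hD L hα₀ hα₁ hα hσ₀ (by
      rw [← Submodule.coe_norm]; norm_num at hθ ⊢; exact hθ.le)
  -- 0.01664 = (4/25)·1.012 - (0.0652 + 0.077·1.04), where 1.04 = 1 + r² bounds the mean of ‖θ‖²
  -- over the ball.
  have h := measure_exists_setIntegral_ball_ge_le (r := 1 / 5) (by norm_num) hmeas hcont hexp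
    (0.01664 * (α₀ * N))
  refine (measure_mono ?_).trans (h.trans (ENNReal.ofReal_le_ofReal ?_))
  · rintro x ⟨u, huL, hu, hx⟩
    refine ⟨⟨u, huL⟩, hu, ?_⟩
    set w : L := ⟨u, huL⟩ with hw
    have hw1 : ‖w‖ = 1 := hu
    have e1 : ∫ θ in Metric.ball w (1 / 5), Φ θ x =
        (∑ i, ∫ θ in Metric.ball w (1 / 5),
          outlierTerm L a (θ : EuclideanSpace ℝ (Fin D)) (x i)) - N * ∫ θ in Metric.ball w (1 / 5), k θ := by
      have i1 : IntegrableOn (fun θ : L ↦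
          ∑ i, outlierTerm L a (θ : EuclideanSpace ℝ (Fin D)) (x i)) (Metric.ball w (1 / 5)) :=
        integrableOn_ball_of_continuous (continuous_finsetSum _ fun i _ ↦ hterm (x i)) _ _
      have i2 : IntegrableOn (fun θ : L ↦ N * k θ) (Metric.ball w (1 / 5)) :=
        integrableOn_ball_of_continuous (continuous_const.mul hk) _ _
      rw [integral_sub i1 i2,
        integral_finsetSum _ fun i _ ↦ integrableOn_ball_of_continuous (hterm (x i)) _ _,
        integral_const_mul]
    set vol := volume.real (Metric.ball w (1 / 5)) with hvol
    have hvol0 : 0 ≤ vol := measureReal_nonneg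
    have e2 : ∫ θ in Metric.ball w (1 / 5), k θ ≤ α₀ * (0.0652 + 0.077 * 1.04) * vol := by
      rw [integral_const_mul, integral_add (integrableOn_ball_of_continuous continuous_const _ _)
        (integrableOn_ball_of_continuous (by fun_prop) _ _), integral_const_mul,
        setIntegral_ball_norm_sq_center (by norm_num), setIntegral_const, smul_eq_mul, hw1, ← hvol]
      have := ballSecondMoment_le L (1 / 5)
      calc α₀ * (vol * 0.0652 + 0.077 * (vol * (1 ^ 2 + ballSecondMoment L (1 / 5))))
          ≤ α₀ * (vol * 0.0652 + 0.077 * (vol * (1 ^ 2 + (1 / 5) ^ 2))) := by gcongr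
        _ = _ := by ring
    have e3 : a * outlierSum L x u * vol ≤
        ∑ i, ∫ θ in Metric.ball w (1 / 5), outlierTerm L a (θ : EuclideanSpace ℝ (Fin D)) (x i) := by
      rw [← sum_outlierTerm, Finset.sum_mul]
      exact Finset.sum_le_sum fun i _ ↦ outlierTerm_le_setIntegral_ball L hapos.le w (x i) _
    have e4 : 4 / 25 * 1.012 * (α₀ * N) ≤ a * outlierSum L x u := by
      have h4 : a * (1.012 * (σ₀ / √D * (α₀ * N))) = 4 / 25 * 1.012 * (α₀ * N) := by
        rw [ha]; field_simp
      rw [← h4]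
      gcongr
    rw [e1]
    have e5 : 4 / 25 * 1.012 * (α₀ * N) * vol ≤ a * outlierSum L x u * vol := by gcongr
    have e6 : N * ∫ θ in Metric.ball w (1 / 5), k θ ≤
        N * (α₀ * (0.0652 + 0.077 * 1.04) * vol) := by gcongr
    have e7 : 0 ≤ α₀ * N * vol := by positivity
    linarith
  -- Here (1 + r)/r = 6 ≤ exp(9/5), and d ≤ α₀N/128 gives (9/5)/128 + 1/400 = 0.0165625 < 0.01664.
  · refine pow_mul_exp_neg_le (T := α₀ * N / 400) (c := 9 / 5) (by norm_num) ?_ ?_ le_rfl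
    · norm_num; exact six_le_exp
    · linarith

end Outliers

/-! ### Uniform lower tail of the inlier quadratic sums -/

section Inliers

variable {D : ℕ}

open Classical in
/-- The contribution of a data point `x` to the exponent controlling the lower tail of
`∑_{x ∈ L} ⟪θ, x⟫² / ‖x‖`. -/
def inlierTerm (L : Submodule ℝ (EuclideanSpace ℝ (Fin D))) (s τ : ℝ)
    (θ x : EuclideanSpace ℝ (Fin D)) : ℝ :=
  if x ∈ L then
    -((√(Module.finrank ℝ L) * (inner ℝ θ x ^ 2 / ‖x‖) -
      s * (‖x‖ / √(Module.finrank ℝ L))) / τ / 10)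
  else 0

open Classical in
/-- The contribution of a data point `x` to `∑_{x ∈ L} ⟪u, x⟫² / ‖x‖`. -/
def quadraticTerm (L : Submodule ℝ (EuclideanSpace ℝ (Fin D)))
    (u x : EuclideanSpace ℝ (Fin D)) : ℝ :=
  if x ∈ L then inner ℝ u x ^ 2 / ‖x‖ else 0

lemma measurable_inlierTerm (L : Submodule ℝ (EuclideanSpace ℝ (Fin D))) (s τ : ℝ) :
    Measurable fun p : EuclideanSpace ℝ (Fin D) × EuclideanSpace ℝ (Fin D) ↦
      inlierTerm L s τ p.1 p.2 := by
  classical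
  exact Measurable.ite (measurable_snd (measurableSet_submodule L))
    (by fun_prop) measurable_const

lemma continuous_inlierTerm (L : Submodule ℝ (EuclideanSpace ℝ (Fin D))) (s τ : ℝ)
    (x : EuclideanSpace ℝ (Fin D)) : Continuous fun θ ↦ inlierTerm L s τ θ x := by
  unfold inlierTerm
  split_ifs <;> fun_prop

/-- Both parts of the statistic are homogeneous of degree one in x, so dividing by τ removes the
scale. -/
lemma inlierTerm_smul (L : Submodule ℝ (EuclideanSpace ℝ (Fin D))) (s : ℝ) {τ : ℝ} (hτ : 0 < τ)
    (θ g : L) :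
    inlierTerm L s τ θ (τ • (g : EuclideanSpace ℝ (Fin D))) =
      -(centeredQuadratic s θ g / 10) := by
  have h : τ • (g : EuclideanSpace ℝ (Fin D)) ∈ L := L.smul_mem _ g.2
  rw [inlierTerm, if_pos h, centeredQuadratic, real_inner_smul_right, norm_smul,
    Real.norm_of_nonneg hτ.le, Submodule.coe_inner, Submodule.coe_norm]
  rcases eq_or_ne ‖(g : EuclideanSpace ℝ (Fin D))‖ 0 with h0 | h0
  · simp [h0]
  · field_simp

/-- A lower bound for `1 - E exp (-T / 10)`, where `T` is `centeredQuadratic s θ` evaluated at a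
standard Gaussian vector of `V`. -/
def lowerTailRate (V : Type*) [NormedAddCommGroup V] [InnerProductSpace ℝ V]
    [FiniteDimensional ℝ V] [MeasurableSpace V] (s : ℝ) (θ : V) : ℝ :=
  meanNorm V * (‖θ‖ ^ 2 - s) / 10 -
    (3 * Module.finrank ℝ V / (Module.finrank ℝ V + 2) * ‖θ‖ ^ 4 + s ^ 2) / 200 - 1 / 10000

lemma lintegral_exp_inlierTerm_le {L : Submodule ℝ (EuclideanSpace ℝ (Fin D))}
    (hL0 : 0 < Module.finrank ℝ L) (hL : Module.finrank ℝ L < D)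
    {α₀ α₁ σ₀ σ₁ : ℝ} (hα₀ : 0 < α₀) (hα₁ : 0 < α₁) (hα : α₀ + α₁ = 1) (hσ₀ : 0 < σ₀)
    (hσ₁ : 0 < σ₁) {s : ℝ} (hs0 : 0 ≤ s) (hs : s ≤ 1 / 9) (θ : L) :
    ∫⁻ x, ENNReal.ofReal (Real.exp (inlierTerm L s (σ₁ / √(Module.finrank ℝ L)) θ x))
      ∂(mixtureMeasure L α₀ α₁ σ₀ σ₁) ≤
      ENNReal.ofReal (1 + -(α₁ * lowerTailRate L s θ)) := by
  set τ := σ₁ / √(Module.finrank ℝ L : ℝ) with hτdef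
  have hτ : 0 < τ := by positivity
  obtain ⟨hi, hle⟩ := integrable_exp_neg_centeredQuadratic hL0 hs0 hs θ
  have hm : Measurable fun x ↦ inlierTerm L s τ (θ : EuclideanSpace ℝ (Fin D)) x :=
    (measurable_inlierTerm L s τ).comp (measurable_const.prodMk measurable_id)
  have h₀ : ∫⁻ x, ENNReal.ofReal (Real.exp (inlierTerm L s τ θ x))
      ∂(outlierMeasure D σ₀) ≤ ENNReal.ofReal 1 := by
    rw [lintegral_congr_ae (g := fun _ ↦ ENNReal.ofReal 1)]
    · simp
    · filter_upwards [ae_notMem_outlierMeasure hL hσ₀] with x hx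
      simp [inlierTerm, hx]
  have h₁ : ∫⁻ x, ENNReal.ofReal (Real.exp (inlierTerm L s τ θ x))
      ∂(inlierMeasure L σ₁) ≤ ENNReal.ofReal (1 - lowerTailRate L s θ) := by
    rw [inlierMeasure_eq_map, lintegral_map (by fun_prop) (by fun_prop)]
    simp_rw [← hτdef, inlierTerm_smul L s hτ]
    rw [← ofReal_integral_eq_lintegral_ofReal hi (ae_of_all _ fun x ↦ (Real.exp_pos _).le)]
    exact ENNReal.ofReal_le_ofReal hle
  -- This number dominates the integral of a nonnegative function.
  have hb : 0 ≤ 1 - lowerTailRate L s θ :=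
    (integral_nonneg fun x ↦ (Real.exp_pos _).le).trans hle
  refine (lintegral_exp_mixtureMeasure_le hα₀.le hα₁.le zero_le_one hb
    h₀ h₁).trans (ENNReal.ofReal_le_ofReal (le_of_eq ?_))
  linear_combination hα

/-- With s the second moment of the ball, the compensator cancels the smoothing bias exactly and the
average is the plain quadratic statistic at the centre. -/
lemma setIntegral_ball_inlierTerm {L : Submodule ℝ (EuclideanSpace ℝ (Fin D))}
    (hL0 : 0 < Module.finrank ℝ L) {τ r : ℝ} (hr : 0 < r) (u : L)
    (x : EuclideanSpace ℝ (Fin D)) :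
    ∫ θ in Metric.ball u r, inlierTerm L (ballSecondMoment L r) τ (θ : L) x =
      -(volume.real (Metric.ball u r) * (√(Module.finrank ℝ L) / τ / 10 *
        quadraticTerm L u x)) := by
  unfold inlierTerm quadraticTerm
  split_ifs with h
  · set s := ballSecondMoment L r with hs
    set d : ℝ := (Module.finrank ℝ L : ℝ) with hd
    have hd0 : 0 < d := by positivity
    have hsd : √d * √d = d := Real.mul_self_sqrt hd0.le
    have hsd0 : √d ≠ 0 := by positivity
    have h1 := setIntegral_ball_inner_sq_center hr u (⟨x, h⟩ : L)
    simp only [Submodule.coe_inner, Submodule.coe_norm] at h1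
    rw [← hs, ← hd] at h1
    have i1 : IntegrableOn (fun θ : L ↦ √d * (inner ℝ (θ : EuclideanSpace ℝ (Fin D)) x ^ 2 / ‖x‖))
        (Metric.ball u r) := integrableOn_ball_of_continuous (by fun_prop) _ _
    have i2 : IntegrableOn (fun _ : L ↦ s * (‖x‖ / √d)) (Metric.ball u r) :=
      integrableOn_ball_of_continuous continuous_const _ _
    rw [integral_neg, integral_div, integral_div, integral_sub i1 i2, integral_const_mul,
      integral_div, h1, setIntegral_const, smul_eq_mul]
    rcases eq_or_ne ‖x‖ 0 with h0 | h0
    · simp [h0]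
    · have : s / d = s / (√d * √d) := by rw [hsd]
      rw [this]
      field_simp
      ring
  · simp

/-- The mean of ‖θ‖² - s over the ball is exactly 1; the fourth moment is at most (1 + r²)² and s² ≤
r⁴. -/
lemma volume_mul_le_setIntegral_lowerTailRate {V : Type*} [NormedAddCommGroup V]
    [InnerProductSpace ℝ V] [FiniteDimensional ℝ V] [MeasurableSpace V] [BorelSpace V]
    (hV : 0 < Module.finrank ℝ V) {r : ℝ} (hr : 0 < r) {u : V} (hu : ‖u‖ = 1) :
    volume.real (Metric.ball u r) * (meanNorm V / 10 -
      (3 * Module.finrank ℝ V / (Module.finrank ℝ V + 2) * (1 + r ^ 2) ^ 2 + r ^ 4) / 200 -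
        1 / 10000) ≤
      ∫ θ in Metric.ball u r, lowerTailRate V (ballSecondMoment V r) θ := by
  set s := ballSecondMoment V r with hs
  set v : ℝ := 3 * (Module.finrank ℝ V : ℝ) / (Module.finrank ℝ V + 2) with hv
  set vol := volume.real (Metric.ball u r) with hvol
  have hvol0 : 0 ≤ vol := measureReal_nonneg
  have hv0 : 0 ≤ v := by positivity
  have ic : ∀ c : ℝ, IntegrableOn (fun _ : V ↦ c) (Metric.ball u r) := fun c ↦
    integrableOn_ball_of_continuous continuous_const _ _
  have i1 : IntegrableOn (fun θ : V ↦ ‖θ‖ ^ 2) (Metric.ball u r) :=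
    integrableOn_ball_of_continuous (by fun_prop) _ _
  have i2 : IntegrableOn (fun θ : V ↦ meanNorm V * (‖θ‖ ^ 2 - s) / 10) (Metric.ball u r) :=
    integrableOn_ball_of_continuous (by fun_prop) _ _
  have i3 : IntegrableOn (fun θ : V ↦ v * ‖θ‖ ^ 4) (Metric.ball u r) :=
    integrableOn_ball_of_continuous (by fun_prop) _ _
  have i4 : IntegrableOn (fun θ : V ↦ (v * ‖θ‖ ^ 4 + s ^ 2) / 200) (Metric.ball u r) :=
    integrableOn_ball_of_continuous (by fun_prop) _ _
  have i5 : IntegrableOn (fun θ : V ↦ meanNorm V * (‖θ‖ ^ 2 - s) / 10 -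
      (v * ‖θ‖ ^ 4 + s ^ 2) / 200) (Metric.ball u r) :=
    integrableOn_ball_of_continuous (by fun_prop) _ _
  have e : ∫ θ in Metric.ball u r, lowerTailRate V s θ =
      meanNorm V * (vol * (1 ^ 2 + s) - vol * s) / 10 -
        (v * (∫ θ in Metric.ball u r, ‖θ‖ ^ 4) + vol * s ^ 2) / 200 - vol * (1 / 10000) := by
    simp only [lowerTailRate, ← hv]
    rw [integral_sub i5 (ic _), integral_sub i2 i4, integral_div, integral_div,
      integral_const_mul, integral_sub i1 (ic _), integral_add i3 (ic _), integral_const_mul,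
      setIntegral_ball_norm_sq_center hr, setIntegral_const, setIntegral_const,
      setIntegral_const, hu, ← hs, ← hvol]
    simp only [smul_eq_mul]
  rw [e]
  have h4 := mul_le_mul_of_nonneg_left (setIntegral_ball_norm_pow_four_le hr hV hu) hv0
  rw [← hvol] at h4
  have hs0 : 0 ≤ s := ballSecondMoment_nonneg V r
  have hs2 : s ^ 2 ≤ r ^ 4 := by
    calc s ^ 2 ≤ (r ^ 2) ^ 2 := by gcongr; exact ballSecondMoment_le V r
      _ = r ^ 4 := by ring
  have h5 := mul_le_mul_of_nonneg_left hs2 hvol0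
  linarith

/-- Here 0.0562 is the threshold 0.562 scaled by 1/10, and 0.0121875 is what the entropy and the
target exponent require. Neither bound on `meanNorm` works in every dimension. For d ≤ 3 the bound
√(2/π) is used with 3d/(d + 2) ≤ 9/5. For d ≥ 4 the bound z = √(d/(d + 2)) is used, and 3d/(d + 2) =
3z² makes this a quadratic inequality in z on [0.816, 1]. -/
lemma rate_le_of_finrank {V : Type*} [NormedAddCommGroup V]
    [InnerProductSpace ℝ V] [FiniteDimensional ℝ V] [MeasurableSpace V] [BorelSpace V]
    (hV : 0 < Module.finrank ℝ V) :
    (0.0121875 : ℝ) ≤ meanNorm V / 10 -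
      (3 * Module.finrank ℝ V / (Module.finrank ℝ V + 2) * (1 + (1 / 3) ^ 2) ^ 2 +
        (1 / 3) ^ 4) / 200 - 1 / 10000 - 0.0562 := by
  set d : ℝ := (Module.finrank ℝ V : ℝ) with hd
  have hd0 : 0 < d := by positivity
  rcases le_or_gt (Module.finrank ℝ V) 3 with h | h
  · have hd3 : d ≤ 3 := by rw [hd]; exact_mod_cast h
    have h1 := (lt_sqrt_two_div_pi).le.trans (sqrt_two_div_pi_le_meanNorm hV)
    have h2 : 3 * d / (d + 2) ≤ 9 / 5 := by
      rw [div_le_iff₀ (by positivity)]; linarith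
    norm_num at h1 h2 ⊢
    linarith
  · have hd4 : 4 ≤ d := by rw [hd]; exact_mod_cast h
    have h1 := sqrt_finrank_div_le_meanNorm (V := V)
    rw [← hd] at h1
    set z := √(d / (d + 2)) with hz
    have hz0 : 0 ≤ z := Real.sqrt_nonneg _
    have hz2 : z ^ 2 = d / (d + 2) := Real.sq_sqrt (by positivity)
    have h2 : 3 * d / (d + 2) = 3 * z ^ 2 := by rw [hz2]; ring
    have h3 : 2 / 3 ≤ z ^ 2 := by
      rw [hz2, le_div_iff₀ (by positivity)]; linarith
    have h4 : z ^ 2 ≤ 1 := by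
      rw [hz2, div_le_iff₀ (by positivity)]; linarith
    have h5 : 0.816 ≤ z := by nlinarith
    have h6 : z ≤ 1 := by nlinarith
    rw [h2]
    norm_num at h5 ⊢
    nlinarith

lemma measure_exists_sum_quadraticTerm_le {L : Submodule ℝ (EuclideanSpace ℝ (Fin D))}
    (hL0 : 0 < Module.finrank ℝ L) (hL : Module.finrank ℝ L < D)
    {α₀ α₁ σ₀ σ₁ : ℝ} (hα₀ : 0 < α₀) (hα₁ : 0 < α₁) (hα : α₀ + α₁ = 1) (hσ₀ : 0 < σ₀)
    (hσ₁ : 0 < σ₁) {N : ℕ} (hN : 128 * (Module.finrank ℝ L : ℝ) ≤ α₁ * N) :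
    (Measure.pi fun _ : Fin N ↦ mixtureMeasure L α₀ α₁ σ₀ σ₁)
      {x | ∃ u ∈ L, ‖u‖ = 1 ∧
        ∑ i, quadraticTerm L u (x i) ≤ 0.562 * (σ₁ / Module.finrank ℝ L * (α₁ * N))} ≤
      ENNReal.ofReal (Real.exp (-(α₁ * N / 800))) := by
  have := isProbabilityMeasure_mixtureMeasure L hα₀.le hα₁.le hα σ₀ σ₁
  set d : ℝ := (Module.finrank ℝ L : ℝ) with hd
  have hd0 : 0 < d := by positivity
  have hsd : √d * √d = d := Real.mul_self_sqrt hd0.le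
  have hsd0 : √d ≠ 0 := by positivity
  set τ := σ₁ / √d with hτdef
  have hτ : 0 < τ := by positivity
  set s := ballSecondMoment L (1 / 3) with hs
  have hs0 : 0 ≤ s := ballSecondMoment_nonneg L _
  have hs9 : s ≤ 1 / 9 := (ballSecondMoment_le L _).trans (by norm_num)
  let k : L → ℝ := fun θ ↦ -(α₁ * lowerTailRate L s θ)
  let Φ : L → (Fin N → EuclideanSpace ℝ (Fin D)) → ℝ := fun θ x ↦
    ∑ i, inlierTerm L s τ (θ : EuclideanSpace ℝ (Fin D)) (x i) - N * k θ
  have hk : Continuous k := by unfold k lowerTailRate; fun_prop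
  have hmeas : Measurable (Function.uncurry Φ) := by
    refine Measurable.sub (Finset.measurable_sum _ fun i _ ↦ ?_)
      ((hk.measurable.comp measurable_fst).const_mul _)
    exact (measurable_inlierTerm L s τ).comp
      (f := fun p : L × (Fin N → EuclideanSpace ℝ (Fin D)) ↦
      ((p.1 : EuclideanSpace ℝ (Fin D)), p.2 i)) (by fun_prop)
  have hterm : ∀ x, Continuous fun θ : L ↦ inlierTerm L s τ (θ : EuclideanSpace ℝ (Fin D)) x :=
    fun x ↦ (continuous_inlierTerm L s τ x).comp continuous_subtype_val
  have hcont : ∀ x, Continuous fun θ ↦ Φ θ x := fun x ↦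
    (continuous_finsetSum _ fun i _ ↦ hterm (x i)).sub (continuous_const.mul hk)
  have hexp : ∀ θ, ‖θ‖ < 1 + 1 / 3 → ∫⁻ x, ENNReal.ofReal (Real.exp (Φ θ x))
      ∂(Measure.pi fun _ : Fin N ↦ mixtureMeasure L α₀ α₁ σ₀ σ₁) ≤ 1 := by
    intro θ _
    refine lintegral_exp_sum_sub_le_one ((measurable_inlierTerm L s τ).comp
      (measurable_const.prodMk measurable_id)) ?_ N
    exact lintegral_exp_inlierTerm_le hL0 hL hα₀ hα₁ hα hσ₀ hσ₁ hs0 hs9 θ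
  have h := measure_exists_setIntegral_ball_ge_le (r := 1 / 3) (by norm_num) hmeas hcont hexp
    (0.0121875 * (α₁ * N))
  refine (measure_mono ?_).trans (h.trans (ENNReal.ofReal_le_ofReal ?_))
  · rintro x ⟨u, huL, hu, hx⟩
    refine ⟨⟨u, huL⟩, hu, ?_⟩
    set w : L := ⟨u, huL⟩ with hw
    have hw1 : ‖w‖ = 1 := hu
    set vol := volume.real (Metric.ball w (1 / 3)) with hvol
    have hvol0 : 0 ≤ vol := measureReal_nonneg
    have e1 : ∫ θ in Metric.ball w (1 / 3), Φ θ x =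
        -(vol * (√d / τ / 10 * ∑ i, quadraticTerm L u (x i))) +
          N * (α₁ * ∫ θ in Metric.ball w (1 / 3), lowerTailRate L s θ) := by
      have i1 : IntegrableOn (fun θ : L ↦
          ∑ i, inlierTerm L s τ (θ : EuclideanSpace ℝ (Fin D)) (x i)) (Metric.ball w (1 / 3)) :=
        integrableOn_ball_of_continuous (continuous_finsetSum _ fun i _ ↦ hterm (x i)) _ _
      have i2 : IntegrableOn (fun θ : L ↦ N * k θ) (Metric.ball w (1 / 3)) :=
        integrableOn_ball_of_continuous (continuous_const.mul hk) _ _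
      rw [integral_sub i1 i2,
        integral_finsetSum _ fun i _ ↦ integrableOn_ball_of_continuous (hterm (x i)) _ _,
        integral_const_mul, integral_neg, integral_const_mul]
      simp_rw [hs, setIntegral_ball_inlierTerm hL0 (by norm_num : (0 : ℝ) < 1 / 3)]
      rw [Finset.sum_neg_distrib, ← Finset.mul_sum, ← Finset.mul_sum]
      ring
    have e2 := volume_mul_le_setIntegral_lowerTailRate (V := L) hL0
      (by norm_num : (0 : ℝ) < 1 / 3) hw1
    have e3 := mul_le_mul_of_nonneg_left (rate_le_of_finrank (V := L) hL0) hvol0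
    rw [← hvol, ← hs] at e2
    have e4 : √d / τ / 10 * ∑ i, quadraticTerm L u (x i) ≤ 0.0562 * (α₁ * N) := by
      calc √d / τ / 10 * ∑ i, quadraticTerm L u (x i)
          ≤ √d / τ / 10 * (0.562 * (σ₁ / d * (α₁ * N))) := by gcongr
        _ = 0.0562 * (α₁ * N) := by
          rw [hτdef]
          nth_rewrite 3 [← hsd]
          field_simp
          ring
    have e5 := mul_le_mul_of_nonneg_left e4 hvol0
    have hA : 0 ≤ α₁ * N := by positivity
    have e6 : vol * 0.0121875 + vol * 0.0562 ≤
        ∫ θ in Metric.ball w (1 / 3), lowerTailRate L s θ := by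
      linarith
    have e7 := mul_le_mul_of_nonneg_left e6 hA
    rw [e1]
    linarith
  -- Here (1 + r)/r = 4 ≤ exp(7/5), and (7/5)/128 + 1/800 is exactly 0.0121875.
  · refine pow_mul_exp_neg_le (T := α₁ * N / 800) (c := 7 / 5) (by norm_num) ?_ ?_ le_rfl
    · norm_num; exact four_le_exp
    · linarith

end Inliers

/-! ### Final numerics and assembly -/

/-- Merges the two outlier failure probabilities into one term. After factoring out exp(-B/800), the
two cofactors are at most 0.863 and 0.137, which sum to 1. -/
lemma exp_neg_add_exp_neg_le {B : ℝ} (hB : 128 ≤ B) :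
    Real.exp (-(B / 400)) + Real.exp (-(0.0197 * B)) ≤ Real.exp (-(B / 800)) := by
  have h1 : Real.exp (-(B / 400)) = Real.exp (-(B / 800)) * Real.exp (-(B / 800)) := by
    rw [← Real.exp_add]; ring_nf
  have h2 : Real.exp (-(0.0197 * B)) =
      Real.exp (-(B / 800)) * Real.exp (-(0.01845 * B)) := by
    rw [← Real.exp_add]; ring_nf
  have key : ∀ t : ℝ, 0 < 1 + t → Real.exp (-t) ≤ 1 / (1 + t) := by
    intro t ht
    rw [Real.exp_neg, ← one_div]
    exact one_div_le_one_div_of_le ht (by linarith [Real.add_one_le_exp t])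
  have h3 : Real.exp (-(B / 800)) ≤ 0.8630 := by
    refine (key _ (by linarith)).trans ?_
    rw [div_le_iff₀ (by linarith)]; linarith
  have h4 : Real.exp (-(0.01845 * B)) ≤ 0.137 := by
    -- Splitting into an 18th power makes the crude bound exp(-t) ≤ 1/(1 + t) sharp enough.
    have h5 : Real.exp (-(0.01845 * B)) = Real.exp (-(0.001025 * B)) ^ 18 := by
      rw [← Real.exp_nat_mul]; ring_nf
    have h6 : Real.exp (-(0.001025 * B)) ≤ 0.8841 := by
      refine (key _ (by linarith)).trans ?_
      rw [div_le_iff₀ (by linarith)]; linarith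
    rw [h5]
    calc _ ≤ (0.8841 : ℝ) ^ 18 := by gcongr
      _ ≤ _ := by norm_num
  have h9 := mul_le_mul_of_nonneg_left (add_le_add h3 h4) (Real.exp_nonneg (-(B / 800)))
  rw [h1, h2]
  linarith

/-- The ratio is at least 2.562, and 1.4143·1.012 < 0.562·2.562. -/
lemma sqrt_two_mul_lt_of_signalToNoise {a b : ℝ} (hb : 0 < b)
    (h : (√(2 / Real.pi) + 1 / 4 + 1 / 10) / (√(2 / Real.pi) - 1 / 4 - 1 / 10) * b < a) :
    √2 * (1.012 * b) < 0.562 * a := by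
  have h1 := sqrt_two_div_pi_lt
  have h2 := lt_sqrt_two_div_pi
  have hR : (2.562 : ℝ) ≤
      (√(2 / Real.pi) + 1 / 4 + 1 / 10) / (√(2 / Real.pi) - 1 / 4 - 1 / 10) := by
    rw [le_div_iff₀ (by linarith)]; linarith
  have h3 : √2 ≤ 1.4143 := by
    rw [Real.sqrt_le_left (by norm_num)]; norm_num
  have h4 := mul_le_mul_of_nonneg_right hR hb.le
  have h5 := mul_le_mul_of_nonneg_right h3 hb.le
  linarith

lemma conditions_of_bounds {D : ℕ} {L : Submodule ℝ (EuclideanSpace ℝ (Fin D))} (hL : L ≠ ⊥) {N : ℕ}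
    {x : Fin N → EuclideanSpace ℝ (Fin D)} {m M : ℝ} (hm0 : 0 ≤ m) (hM0 : 0 ≤ M)
    (hmM : √2 * M < m) {v : EuclideanSpace ℝ (Fin D)} (hv : v ∈ Lᗮ) (hv1 : ‖v‖ = 1)
    (hxv : outlierSum L x v ≤ M) (hxL : ∀ u ∈ L, ‖u‖ = 1 → outlierSum L x u ≤ M)
    (hxm : ∀ u ∈ L, ‖u‖ = 1 → m ≤ ∑ i, quadraticTerm L u (x i)) :
    Condition1 L x ∧ Condition2 L x := by
  have h := hmM.trans_le (le_inlierMin hL hm0 hxm)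
  have h2 : (0 : ℝ) ≤ √2 := Real.sqrt_nonneg _
  exact ⟨(mul_le_mul_of_nonneg_left ((outlierMinPerp_le x hv hv1).trans hxv) h2).trans_lt h,
    (mul_le_mul_of_nonneg_left (outlierMax_le hM0 hxL) h2).trans_lt h⟩

end NeedleHaystack

end

open NeedleHaystack in
theorem mainTheorem7
    {D d N : ℕ} (hd : 1 ≤ d) (hdD : d < D)
    (L : Submodule ℝ (EuclideanSpace ℝ (Fin D))) (hL : Module.finrank ℝ L = d)
    {α₀ α₁ σ₀ σ₁ : ℝ} (hα₀ : 0 < α₀) (hα₁ : 0 < α₁) (hα : α₀ + α₁ = 1)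
    (hσ₀ : 0 < σ₀) (hσ₁ : 0 < σ₁)
    {Ω : Type*} [MeasurableSpace Ω] (P : Measure Ω) [IsProbabilityMeasure P]
    (X : Fin N → Ω → EuclideanSpace ℝ (Fin D))
    (hindep : iIndepFun X P)
    (hlaw : ∀ i, HasLaw (X i) (NeedleHaystack.mixtureMeasure L α₀ α₁ σ₀ σ₁) P)
    (hSNR : α₁ / α₀ > σ₀ / σ₁ *
      ((√(2 / Real.pi) + 1 / 4 + 1 / 10) / (√(2 / Real.pi) - 1 / 4 - 1 / 10)) *
      √((d : ℝ) ^ 2 / (D : ℝ)))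
    (hN : (N : ℝ) > 64 * max (2 * (d : ℝ) / α₁)
      (max (2 * (d : ℝ) / α₀) (2 * ((D : ℝ) - (d : ℝ)) / α₀))) :
    P.real {ω | NeedleHaystack.Condition1 L (fun i => X i ω) ∧
        NeedleHaystack.Condition2 L (fun i => X i ω)} ≥
      1 - Real.exp (-(α₁ ^ 2 * (N : ℝ) / 2)) - 2 * Real.exp (-(α₀ ^ 2 * (N : ℝ) / 2))
        - Real.exp (-(α₁ * (N : ℝ) / 800)) - Real.exp (-(α₀ * (N : ℝ) / 800)) := by
  have hd' : (1 : ℝ) ≤ d := by exact_mod_cast hd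
  have hD : 0 < D := by omega
  have hfin : 0 < Module.finrank ℝ L := by omega
  have hLD : Module.finrank ℝ L < D := by omega
  have hLbot : L ≠ ⊥ := by
    rintro rfl
    simp at hfin
  have hN1 : 128 * (d : ℝ) ≤ α₁ * N := by
    have h1 : 64 * (2 * (d : ℝ) / α₁) ≤ N :=
      (mul_le_mul_of_nonneg_left (le_max_left _ _) (by norm_num)).trans hN.le
    have h2 := mul_le_mul_of_nonneg_left h1 hα₁.le
    field_simp at h2
    linarith
  have hN0 : 128 * (d : ℝ) ≤ α₀ * N := by
    have h1 : 64 * (2 * (d : ℝ) / α₀) ≤ N :=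
      (mul_le_mul_of_nonneg_left ((le_max_left _ _).trans (le_max_right _ _))
        (by norm_num)).trans hN.le
    have h2 := mul_le_mul_of_nonneg_left h1 hα₀.le
    field_simp at h2
    linarith
  have hNpos : (0 : ℝ) < N := pos_of_mul_pos_right (by linarith : 0 < α₀ * (N : ℝ)) hα₀.le
  set m : ℝ := 0.562 * (σ₁ / Module.finrank ℝ L * (α₁ * N)) with hm
  set M : ℝ := 1.012 * (σ₀ / √D * (α₀ * N)) with hM
  have hmM : √2 * M < m := by
    refine sqrt_two_mul_lt_of_signalToNoise (by positivity) ?_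
    have hs : √((d : ℝ) ^ 2 / D) = d / √D := by
      rw [Real.sqrt_div (by positivity), Real.sqrt_sq (by positivity)]
    rw [hs, gt_iff_lt, lt_div_iff₀ hα₀] at hSNR
    have h1 := mul_lt_mul_of_pos_left hSNR (by positivity : 0 < σ₁ / d * N)
    rw [hL]
    have h3 : (0 : ℝ) < d := by linarith
    generalize (√(2 / Real.pi) + 1 / 4 + 1 / 10) / (√(2 / Real.pi) - 1 / 4 - 1 / 10) = R at h1 ⊢
    calc R * (σ₀ / √D * (α₀ * N)) = σ₁ / d * N * (σ₀ / σ₁ * R * (d / √D) * α₀) := by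
          field_simp
      _ < σ₁ / d * N * α₁ := h1
      _ = _ := by ring
  obtain ⟨v, hv, hv1⟩ := exists_mem_orthogonal_norm_eq_one hLD
  have hprob := isProbabilityMeasure_mixtureMeasure L hα₀.le hα₁.le hα σ₀ σ₁
  have hmeas : ∀ i, AEMeasurable (X i) P := fun i ↦ (hlaw i).aemeasurable
  have hmap : P.map (fun ω i ↦ X i ω) =
      Measure.pi fun _ : Fin N ↦ mixtureMeasure L α₀ α₁ σ₀ σ₁ := by
    rw [(iIndepFun_iff_map_fun_eq_pi_map hmeas).1 hindep]
    simp_rw [fun i ↦ (hlaw i).map_eq]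
  have hjoint : AEMeasurable (fun ω i ↦ X i ω) P := aemeasurable_pi_lambda _ hmeas
  -- The bad events are uncountable unions over u; `Measure.le_map_apply` transfers the bound for
  -- arbitrary S, without measurability.
  have hpull : ∀ (S : Set (Fin N → EuclideanSpace ℝ (Fin D))) (r : ℝ),
      (Measure.pi fun _ : Fin N ↦ mixtureMeasure L α₀ α₁ σ₀ σ₁) S ≤
        ENNReal.ofReal (Real.exp r) →
      P.real ((fun ω i ↦ X i ω) ⁻¹' S) ≤ Real.exp r := by
    intro S r h
    rw [← hmap] at h
    exact ENNReal.toReal_le_of_le_ofReal (Real.exp_nonneg r) ((Measure.le_map_apply hjoint S).trans h)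
  have b1 := hpull _ _ (measure_exists_sum_quadraticTerm_le hfin hLD hα₀ hα₁ hα hσ₀ hσ₁
    (by rwa [hL]))
  have b2 := hpull _ _ (measure_exists_outlierSum_gt_le (σ₁ := σ₁) hD L hα₀ hα₁ hα hσ₀
    (by rwa [hL]))
  have b3 := hpull _ _ (measure_outlierSum_ge_le (σ₁ := σ₁) hD L hα₀ hα₁ hα hσ₀ hv1 N)
  set good := {ω | Condition1 L (fun i => X i ω) ∧ Condition2 L (fun i => X i ω)} with hgood
  set B1 := (fun ω i ↦ X i ω) ⁻¹' {x | ∃ u ∈ L, ‖u‖ = 1 ∧ ∑ i, quadraticTerm L u (x i) ≤ m}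
  set B2 := (fun ω i ↦ X i ω) ⁻¹' {x | ∃ u ∈ L, ‖u‖ = 1 ∧ M ≤ outlierSum L x u}
  set B3 := (fun ω i ↦ X i ω) ⁻¹' {x | M ≤ outlierSum L x v}
  -- Covering the whole space and using subadditivity avoids taking the complement of the good
  -- event, whose measurability is not established.
  have hcover : Set.univ ⊆ good ∪ (B1 ∪ (B2 ∪ B3)) := by
    intro ω _
    by_contra hω
    simp only [Set.mem_union, not_or] at hω
    obtain ⟨hg, h1, h2, h3⟩ := hω
    simp only [B1, B2, B3, Set.mem_preimage, Set.mem_ofPred_eq, not_exists, not_and, not_le]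
      at h1 h2 h3
    exact hg (conditions_of_bounds hLbot (by positivity) (by positivity) hmM hv hv1 h3.le
      (fun u hu hu1 ↦ (h2 u hu hu1).le) fun u hu hu1 ↦ (h1 u hu hu1).le)
  have htotal : 1 ≤ P.real good + (P.real B1 + (P.real B2 + P.real B3)) :=
    calc (1 : ℝ) = P.real Set.univ := probReal_univ.symm
      _ ≤ P.real (good ∪ (B1 ∪ (B2 ∪ B3))) := measureReal_mono hcover
      _ ≤ P.real good + (P.real B1 + (P.real B2 + P.real B3)) :=
        (measureReal_union_le _ _).trans (by
          gcongr
          refine (measureReal_union_le _ _).trans ?_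
          gcongr
          exact measureReal_union_le _ _)
  have htail := exp_neg_add_exp_neg_le (B := α₀ * N) (by linarith)
  -- The two cluster-size terms are only needed to be nonnegative, since they weaken the bound.
  have p1 := Real.exp_nonneg (-(α₁ ^ 2 * (N : ℝ) / 2))
  have p2 := Real.exp_nonneg (-(α₀ ^ 2 * (N : ℝ) / 2))
  linarith
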